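/- For $\alpha\in(0,2)$ let $\Lambda^\alpha=(-d^2/dx^2)^{\alpha/2}$ be the operator on $\mathbb R$ with Fourier symbol $|\xi|^\alpha$ (for the Fourier kernel $e^{-ix\xi}$), extended to bounded, sufficiently smooth functions $w$, not necessarily decaying at infinity, by the (absolutely convergent) Lévy–Khintchine formula $$-\Lambda^\alpha w(x)=C(\alpha)\int_{\mathbb R}\Bigl\{w(x+z)-w(x)-z\,w'(x)\,\mathbf 1_{\{|z|\le 1\}}\Bigr\}\frac{dz}{|z|^{1+\alpha}},\qquad C(\alpha)=\frac{\alpha\,2^{\alpha-1}\,\Gamma\left(\frac{1+\alpha}{2}\right)}{\sqrt{\pi}\;\Gamma\left(1-\frac{\alpha}{2}\right)}.$$ Let $v_\alpha(x)=K(\alpha)(1-x^2)^{\alpha/2}$ for $|x|<1$ and $v_\alpha(x)=0$ for $|x|\ge 1$, where $K(\alpha)=\Gamma(1/2)\left[2^\alpha\,\Gamma(1+\alpha/2)\,\Gamma((1+\alpha)/2)\right]^{-1}$ (Getoor's function). **Theorem (existence of a self-similar profile).** Let $\alpha\in(0,2)$. Then $\Lambda^\alpha v_\alpha(x)=1$ for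 all $x\in(-1,1)$. Moreover, there exist $y_\alpha>0$ and a nondecreasing function $\Phi_\alpha:\mathbb R\to\mathbb R$ such that $\Phi_\alpha$ is of class $C^{1+\alpha/2}$ on $\mathbb R$ (it is $C^1$ and its derivative is Hölder continuous of exponent $\alpha/2$), $\Phi_\alpha$ is real-analytic on $(-y_\alpha,y_\alpha)$, $$\Phi_\alpha=0\ \text{ on }(-\infty,-y_\alpha),\qquad \Phi_\alpha=1\ \text{ on }(y_\alpha,+\infty),$$ and $$(\Lambda^\alpha\Phi_\alpha)(y)=\frac{y}{\alpha+1}\quad\text{for all } y\in(-y_\alpha,y_\alpha).$$ The function $\Phi_\alpha$ can be chosen of the form $\Phi_\alpha(y)=c\int_{-y_\alpha}^{y}v_\alpha(t/y_\alpha)\,dt$ for all $y\in\mathbb R$, with a constant $c>0$. -/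

import Mathlib

/-- The constant in the Lévy–Khintchine representation of the one-dimensional operator with
Fourier symbol `|ξ| ^ α` (Fourier kernel `exp (-i x ξ)`), that is, the inverse of the integral of
`(1 - cos z) / |z| ^ (1 + α)` over the real line. -/
noncomputable def levyConst (α : ℝ) : ℝ :=
  α * (2 : ℝ) ^ (α - 1) * Real.Gamma ((1 + α) / 2) /
    (Real.sqrt Real.pi * Real.Gamma (1 - α / 2))

/-- The integrand of the Lévy–Khintchine formula at the point `x`. -/
noncomputable def levyIntegrand (α : ℝ) (w : ℝ → ℝ) (x z : ℝ) : ℝ :=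
  (w (x + z) - w x - (if |z| ≤ 1 then z * deriv w x else 0)) / |z| ^ (1 + α)

/-- The fractional Laplacian `Λ^α w = (-d²/dx²)^(α/2) w` of `w` exists at `x`, in the sense of an
absolutely convergent Lévy–Khintchine integral, and is equal to `l`. -/
def HasFracLapAt (α : ℝ) (w : ℝ → ℝ) (x l : ℝ) : Prop :=
  DifferentiableAt ℝ w x ∧
    MeasureTheory.Integrable (levyIntegrand α w x) MeasureTheory.volume ∧
    -(levyConst α * ∫ z : ℝ, levyIntegrand α w x z) = l

/-- Regularity `C^{1+β}` for `0 < β < 1`: continuously differentiable, with a derivative that is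
Hölder continuous of exponent `β` on the whole line. -/
def IsC1Holder (β : ℝ) (w : ℝ → ℝ) : Prop :=
  ContDiff ℝ 1 w ∧ ∃ C : NNReal, HolderWith C (Real.toNNReal β) (deriv w)

/-- The normalizing constant of Getoor's function. -/
noncomputable def getoorConst (α : ℝ) : ℝ :=
  Real.Gamma (1 / 2) /
    ((2 : ℝ) ^ α * Real.Gamma (1 + α / 2) * Real.Gamma ((1 + α) / 2))

/-- Getoor's function: `K(α) (1 - x²)^(α/2)` for `|x| < 1` and `0` for `|x| ≥ 1`. -/
noncomputable def getoorFun (α x : ℝ) : ℝ :=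
  if |x| < 1 then getoorConst α * (1 - |x| ^ 2) ^ (α / 2) else 0

/-!
Write `a = α / 2` and `u x = (1 - x²)₊ ^ a` (`truncPow`). The heart of the matter is that the
Lévy–Khintchine integral of `u` at every point `x` of `(-1, 1)` equals `-Γ(1 - a) Γ(a)`
(`integral_levyIntegrand_truncPow`); the constants `levyConst` and `getoorConst` are such that
this gives `Λ v = 1` for Getoor's function `v`.

The integral is absolutely convergent, hence the limit of the integrals outside small intervals
around the origin, and the intervals may be chosen freely. They are taken symmetric in the
coordinate `w` given by the Möbius automorphism `y = (x + w) / (1 + x w)` of `(-1, 1)`. Since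
`1 - y² = (1 - x²) (1 - w²) / (1 + x w)²`, the part of the integral that contains `u y` becomes
`(1 - x²) ^ (-a) ∫ (1 - w²) ^ a / (1 + x w) · |w| ^ (-1 - 2 a) dw`, while the part that contains
`u x` is explicit. Adding the contributions of `w` and `-w` and substituting `t = w² / (1 - w²)`
leaves `∫ t ^ (-1 - a) / (1 + (1 - x²) t) dt` over a half-line `t > T`; its divergent part
cancels against the explicit terms up to `O(ε ^ (2 - 2 a))`, and the rest converges to a beta
integral. The compensator contributes `O(ε ^ (2 - 2 a))` as well, because the chosen interval is
symmetric up to `O(ε²)`.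

The profile is a rescaled primitive of `v`. For the primitive `V` that vanishes left of `-1`
(`getoorPrim`), differentiation under the integral sign gives `(Λ V)' = Λ v = 1` on `(-1, 1)`,
and `Λ V` vanishes at `0` because `V - V 0` is odd; so `Λ V x = x` (`hasFracLapAt_getoorPrim`).
The homogeneity of `Λ` (`HasFracLapAt.comp_div`) then fixes the radius `y_α` and the constant `c`
from the slope `1 / (α + 1)` and the total increment `1`. Analyticity of `V` inside `(-1, 1)` comes
from a holomorphic primitive of `z ↦ (1 - z²) ^ a` on the unit disc, and the Hölder bound from
the subadditivity of `s ↦ s ^ a`.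
-/

open MeasureTheory Set Filter Topology

/-! ### Linearity, scaling and integrability of the Lévy–Khintchine integrand -/

theorem levyIntegrand_const_mul (α c : ℝ) (w : ℝ → ℝ) (x : ℝ) :
    levyIntegrand α (fun y => c * w y) x = fun z => c * levyIntegrand α w x z := by
  funext z
  simp only [levyIntegrand, deriv_const_mul_field]
  split_ifs <;> ring

theorem HasFracLapAt.const_mul {α x l : ℝ} {w : ℝ → ℝ} (h : HasFracLapAt α w x l) (c : ℝ) :
    HasFracLapAt α (fun y => c * w y) x (c * l) := by
  obtain ⟨hd, hi, he⟩ := h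
  refine ⟨hd.const_mul c, ?_, ?_⟩
  · rw [levyIntegrand_const_mul]
    exact hi.const_mul c
  · rw [levyIntegrand_const_mul, integral_const_mul, ← he]
    ring

/-- An odd function has integral zero (also when it is not integrable, by the convention on
the value of the integral). -/
theorem integral_eq_zero_of_odd {f : ℝ → ℝ} (hf : ∀ z, f (-z) = -f z) : ∫ z, f z = 0 := by
  have h := integral_neg_eq_self f volume
  simp only [hf, integral_neg] at h
  linarith

/-- Changing the cutoff `1` of the compensator to another radius changes the integrand by an
integrable odd function. -/
theorem integrable_cutoff_sub (α : ℝ) {r : ℝ} (hr : 0 < r) :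
    Integrable (fun z : ℝ => ((if |z| ≤ 1 then z else 0) - (if |z| ≤ r then z else 0)) /
      |z| ^ (1 + α)) := by
  set m := min 1 r with hm
  set M := max 1 r with hM
  have hm0 : 0 < m := by positivity
  have hc : ContinuousOn (fun z : ℝ => |z| / |z| ^ (1 + α)) (Icc (-M) (-m) ∪ Icc m M) := by
    intro z hz
    have hz0 : |z| ≠ 0 := by
      rw [abs_ne_zero]
      rcases hz with hz | hz
      · exact (lt_of_le_of_lt hz.2 (by linarith)).ne
      · exact (lt_of_lt_of_le hm0 hz.1).ne'
    apply ContinuousAt.continuousWithinAt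
    exact continuousAt_id.abs.div (continuousAt_id.abs.rpow_const (Or.inl hz0))
      (by positivity)
  have hI : IntegrableOn (fun z : ℝ => |z| / |z| ^ (1 + α)) (Icc (-M) (-m) ∪ Icc m M) :=
    hc.integrableOn_compact (isCompact_Icc.union isCompact_Icc)
  have hI2 := (integrable_indicator_iff (measurableSet_Icc.union measurableSet_Icc)).2 hI
  refine hI2.mono' ?_ (Eventually.of_forall fun z => ?_)
  · refine Measurable.aestronglyMeasurable ?_
    refine Measurable.div (Measurable.sub ?_ ?_) (by fun_prop)
    · exact Measurable.ite (measurableSet_le (by fun_prop) (by fun_prop)) measurable_id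
        measurable_const
    · exact Measurable.ite (measurableSet_le (by fun_prop) (by fun_prop)) measurable_id
        measurable_const
  · have key : z ∉ Icc (-M) (-m) ∪ Icc m M →
        (if |z| ≤ 1 then z else 0) - (if |z| ≤ r then z else 0) = 0 := by
      intro hz
      have h1 : |z| < m ∨ M < |z| := by
        by_contra! hcon
        apply hz
        rcases abs_cases z with ⟨h, h'⟩ | ⟨h, h'⟩
        · right; constructor <;> linarith
        · left; constructor <;> linarith
      rcases h1 with h1 | h1
      · rw [if_pos (h1.le.trans (min_le_left _ _)), if_pos (h1.le.trans (min_le_right _ _)),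
          sub_self]
      · rw [if_neg (not_le.2 ((le_max_left _ _).trans_lt h1)),
          if_neg (not_le.2 ((le_max_right _ _).trans_lt h1)), sub_self]
    by_cases hz : z ∈ Icc (-M) (-m) ∪ Icc m M
    · rw [indicator_of_mem hz, norm_div, Real.norm_eq_abs,
        Real.norm_of_nonneg (by positivity : 0 ≤ |z| ^ (1 + α))]
      refine div_le_div_of_nonneg_right ?_ (by positivity)
      split_ifs <;> simp
    · rw [indicator_of_notMem hz, key hz]
      simp

theorem levyIntegrand_comp_div {α r : ℝ} (hr : 0 < r) (w : ℝ → ℝ) (x z : ℝ) :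
    levyIntegrand α (fun y => w (y / r)) (r * x) z =
      r⁻¹ ^ (1 + α) * (levyIntegrand α w x (z / r)) -
      (deriv w x / r) * (((if |z| ≤ 1 then z else 0) - (if |z| ≤ r then z else 0)) /
        |z| ^ (1 + α)) := by
  have h1 : deriv (fun y => w (y / r)) (r * x) = deriv w x / r := by
    have := deriv_comp_mul_left r⁻¹ w (r * x)
    simp only [← mul_assoc, inv_mul_cancel₀ hr.ne', one_mul, smul_eq_mul] at this
    simp only [div_eq_inv_mul, this]
  have h2 : |z / r| = |z| / r := by rw [abs_div, abs_of_pos hr]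
  have h3 : (|z| / r ≤ 1) = (|z| ≤ r) := by rw [div_le_one hr]
  have h4 : (|z| / r) ^ (1 + α) = r⁻¹ ^ (1 + α) * |z| ^ (1 + α) := by
    rw [div_eq_mul_inv, Real.mul_rpow (abs_nonneg z) (by positivity), mul_comm]
  have h5 : (r * x + z) / r = x + z / r := by field_simp
  have h6 : r * x / r = x := by field_simp
  have hr' : r⁻¹ ^ (1 + α) ≠ 0 := by positivity
  simp only [levyIntegrand, h1, h2, h3, h4, h5, h6]
  have h7 : ∀ A B : ℝ, r⁻¹ ^ (1 + α) * (A / (r⁻¹ ^ (1 + α) * B)) = A / B := fun A B => by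
    rw [mul_div_assoc', mul_div_mul_left _ _ hr']
  rw [h7]
  split_ifs <;> ring

/-- Homogeneity of `Λ^α`. The dilation turns the cutoff `1` of the compensator into the cutoff `r`,
which does not change the integral. -/
theorem HasFracLapAt.comp_div {α x l : ℝ} {w : ℝ → ℝ} (h : HasFracLapAt α w x l) {r : ℝ}
    (hr : 0 < r) : HasFracLapAt α (fun y => w (y / r)) (r * x) (r⁻¹ ^ α * l) := by
  obtain ⟨hd, hi, he⟩ := h
  have hfun := funext (levyIntegrand_comp_div (α := α) hr w x)
  have hi1 : Integrable (fun z => r⁻¹ ^ (1 + α) * levyIntegrand α w x (z / r)) :=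
    (hi.comp_div hr.ne').const_mul _
  have hi2 := (integrable_cutoff_sub α hr).const_mul (deriv w x / r)
  refine ⟨?_, ?_, ?_⟩
  · have h6 : r * x / r = x := by field_simp
    exact DifferentiableAt.comp (r * x) (g := w) (f := fun y => y / r) (by simpa only [h6] using hd)
      (by fun_prop)
  · rw [hfun]
    exact hi1.sub hi2
  · rw [hfun, integral_sub hi1 hi2, integral_const_mul, integral_const_mul,
      Measure.integral_comp_div, integral_eq_zero_of_odd (f := fun z : ℝ =>
        ((if |z| ≤ 1 then z else 0) - (if |z| ≤ r then z else 0)) / |z| ^ (1 + α)), ← he,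
      Real.rpow_add (by positivity), Real.rpow_one, abs_of_pos hr, smul_eq_mul]
    · field_simp
      ring
    · intro z
      simp only [abs_neg]
      split_ifs <;> ring

/-- The majorant of all Lévy–Khintchine integrands used below. -/
theorem integrable_min_sq_one_div {α : ℝ} (hα : α ∈ Ioo (0 : ℝ) 2) :
    Integrable (fun z : ℝ => min (z ^ 2) 1 / |z| ^ (1 + α)) := by
  have h0 : IntegrableOn (fun z : ℝ => min (z ^ 2) 1 / |z| ^ (1 + α)) (Ioi 0) := by
    rw [← Ioo_union_Ici_eq_Ioi zero_lt_one, integrableOn_union]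
    constructor
    · have := (intervalIntegral.integrableOn_Ioo_rpow_iff (s := 1 - α) zero_lt_one).2
        (by linarith [hα.2])
      refine this.congr_fun (fun z hz => ?_) measurableSet_Ioo
      have hz2 : z ^ 2 ≤ 1 := by nlinarith [hz.1, hz.2]
      simp only [abs_of_pos hz.1, min_eq_left hz2]
      rw [← Real.rpow_natCast z 2, ← Real.rpow_sub hz.1]
      norm_num
      ring_nf
    · rw [integrableOn_Ici_iff_integrableOn_Ioi]
      have := (integrableOn_Ioi_rpow_iff (s := -(1 + α)) zero_lt_one).2 (by linarith [hα.1])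
      refine this.congr_fun (fun z hz => ?_) measurableSet_Ioi
      have hz : (1 : ℝ) < z := hz
      have hz2 : 1 ≤ z ^ 2 := by nlinarith
      simp only [abs_of_pos (zero_lt_one.trans hz), min_eq_right hz2]
      rw [Real.rpow_neg (by linarith), one_div]
  have h1 : IntegrableOn (fun z : ℝ => min (z ^ 2) 1 / |z| ^ (1 + α)) (Iio 0) := by
    have := IntegrableOn.comp_neg_Iio (c := (0 : ℝ)) (by rwa [neg_zero])
    simpa only [abs_neg, neg_sq] using this
  rw [← integrableOn_univ, ← Iic_union_Ioi (a := (0 : ℝ)), integrableOn_union,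
    integrableOn_Iic_iff_integrableOn_Iio]
  exact ⟨h1, h0⟩

/-- A bound on the numerator of the Lévy–Khintchine integrand that is uniform near `x₀`, for a
bounded function with a derivative that is Lipschitz near `x₀`. -/
theorem exists_abs_levyIntegrand_le {w w' : ℝ → ℝ} {x₀ r M L : ℝ} (α : ℝ) (hr : 0 < r)
    (hM : ∀ x, |w x| ≤ M) (hw : ∀ x ∈ Metric.ball x₀ (2 * r), HasDerivAt w (w' x) x)
    (hL : ∀ x ∈ Metric.ball x₀ (2 * r), ∀ y ∈ Metric.ball x₀ (2 * r),
      |w' x - w' y| ≤ L * |x - y|) :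
    ∃ C, ∀ x ∈ Metric.ball x₀ r, ∀ z,
      |levyIntegrand α w x z| ≤ C * (min (z ^ 2) 1 / |z| ^ (1 + α)) := by
  have hM0 : 0 ≤ M := (abs_nonneg _).trans (hM 0)
  set D := |w' x₀| + |L| * r
  have hD0 : 0 ≤ D := by positivity
  set m := min r 1
  have hm0 : 0 < m := by positivity
  have hx₀ : x₀ ∈ Metric.ball x₀ (2 * r) := Metric.mem_ball_self (by positivity)
  refine ⟨|L| + (2 * M + D) / m ^ 2, fun x hx z => ?_⟩
  have hxr : |x - x₀| < r := by rwa [← Real.dist_eq]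
  have hx2 : x ∈ Metric.ball x₀ (2 * r) := Metric.ball_subset_ball (by linarith) hx
  have hD : |w' x| ≤ D := by
    have h1 := hL x hx2 x₀ hx₀
    have h2 : L * |x - x₀| ≤ |L| * r :=
      mul_le_mul (le_abs_self L) hxr.le (abs_nonneg _) (abs_nonneg _)
    have h3 := abs_sub_abs_le_abs_sub (w' x) (w' x₀)
    simp only [D]
    linarith
  rw [levyIntegrand, (hw x hx2).deriv, abs_div,
    abs_of_nonneg (by positivity : 0 ≤ |z| ^ (1 + α)), mul_div_assoc']
  refine div_le_div_of_nonneg_right ?_ (by positivity)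
  rcases lt_or_ge |z| m with hz | hz
  · have hz1 : |z| ≤ 1 := hz.le.trans (min_le_right _ _)
    have hzr : |z| < r := hz.trans_le (min_le_left _ _)
    have hz2 : z ^ 2 ≤ 1 := by rw [← sq_abs]; nlinarith [abs_nonneg z]
    have hsub : ∀ y ∈ Metric.closedBall x |z|, y ∈ Metric.ball x₀ (2 * r) := by
      intro y hy
      rw [Metric.mem_closedBall] at hy
      rw [Metric.mem_ball] at hx ⊢
      linarith [dist_triangle y x x₀]
    have hmv := (convex_closedBall x |z|).norm_image_sub_le_of_norm_hasDerivWithin_le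
      (f := fun y => w y - y * w' x) (f' := fun y => w' y - w' x) (C := |L| * |z|)
      (x := x) (y := x + z)
      (fun y hy => ((hw y (hsub y hy)).sub
        (by simpa using (hasDerivAt_id y).mul_const (w' x))).hasDerivWithinAt)
      (fun y hy => by
        refine (hL y (hsub y hy) x hx2).trans ?_
        rw [Metric.mem_closedBall, Real.dist_eq] at hy
        exact mul_le_mul (le_abs_self L) hy (abs_nonneg _) (abs_nonneg _))
      (Metric.mem_closedBall_self (abs_nonneg _)) (by simp)
    rw [if_pos hz1, min_eq_left hz2]
    have h1 : w (x + z) - w x - z * w' x = w (x + z) - (x + z) * w' x - (w x - x * w' x) := by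
      ring
    rw [h1, ← sq_abs z]
    simp only [Real.norm_eq_abs, add_sub_cancel_left] at hmv
    have h2 : 0 ≤ (2 * M + D) / m ^ 2 * |z| ^ 2 := by positivity
    linarith
  · have h1 : |w (x + z) - w x - (if |z| ≤ 1 then z * w' x else 0)| ≤ 2 * M + D := by
      have h2 : |if |z| ≤ 1 then z * w' x else 0| ≤ D := by
        split_ifs with h
        · rw [abs_mul]
          nlinarith [abs_nonneg z, abs_nonneg (w' x)]
        · simpa using hD0
      have h3 := abs_sub (w (x + z) - w x) (if |z| ≤ 1 then z * w' x else 0)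
      have h4 := abs_sub (w (x + z)) (w x)
      linarith [hM (x + z), hM x]
    have h5 : m ^ 2 ≤ min (z ^ 2) 1 := by
      refine le_min ?_ ?_
      · rw [← sq_abs z]
        gcongr
      · have : m ≤ 1 := min_le_right _ _
        nlinarith
    calc _ ≤ 2 * M + D := h1
      _ = (2 * M + D) / m ^ 2 * m ^ 2 := by field_simp
      _ ≤ (2 * M + D) / m ^ 2 * min (z ^ 2) 1 := by gcongr
      _ ≤ _ := by
        gcongr
        linarith [abs_nonneg L]

theorem integrable_levyIntegrand {α : ℝ} (hα : α ∈ Ioo (0 : ℝ) 2) {w : ℝ → ℝ} {x C : ℝ}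
    (hw : Continuous w)
    (hC : ∀ z, |levyIntegrand α w x z| ≤ C * (min (z ^ 2) 1 / |z| ^ (1 + α))) :
    Integrable (levyIntegrand α w x) := by
  refine ((integrable_min_sq_one_div hα).const_mul C).mono' ?_ (Eventually.of_forall hC)
  refine Measurable.aestronglyMeasurable ?_
  refine Measurable.div (Measurable.sub ?_ ?_) (by fun_prop)
  · exact ((hw.comp (continuous_const.add continuous_id)).sub continuous_const).measurable
  · exact Measurable.ite (measurableSet_le (by fun_prop) (by fun_prop)) (by fun_prop)
      measurable_const

/-! ### Truncated powers of `1 - x²` -/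

/-- The power `(1 - x²)₊ ^ a`, extended by zero outside `[-1, 1]`. -/
noncomputable def truncPow (a x : ℝ) : ℝ := max (1 - x ^ 2) 0 ^ a

theorem truncPow_of_abs_le {a x : ℝ} (hx : |x| ≤ 1) : truncPow a x = (1 - x ^ 2) ^ a := by
  have : x ^ 2 ≤ 1 := by rw [← sq_abs]; nlinarith [abs_nonneg x]
  rw [truncPow, max_eq_left (by linarith)]

theorem truncPow_of_one_le_abs {a x : ℝ} (ha : 0 < a) (hx : 1 ≤ |x|) : truncPow a x = 0 := by
  have : 1 ≤ x ^ 2 := by rw [← sq_abs]; nlinarith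
  rw [truncPow, max_eq_right (by linarith), Real.zero_rpow ha.ne']

theorem truncPow_neg (a x : ℝ) : truncPow a (-x) = truncPow a x := by
  simp [truncPow]

theorem truncPow_nonneg (a x : ℝ) : 0 ≤ truncPow a x := by
  unfold truncPow; positivity

theorem truncPow_le_one {a : ℝ} (ha : 0 < a) (x : ℝ) : truncPow a x ≤ 1 :=
  Real.rpow_le_one (le_max_right _ _) (max_le (by nlinarith [sq_nonneg x]) zero_le_one) ha.le

theorem continuous_truncPow {a : ℝ} (ha : 0 < a) : Continuous (truncPow a) := by
  unfold truncPow
  exact Continuous.rpow_const (by fun_prop) (fun _ => Or.inr ha.le)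

theorem hasDerivAt_truncPow {a x : ℝ} (hx : x ∈ Ioo (-1 : ℝ) 1) :
    HasDerivAt (truncPow a) (a * (1 - x ^ 2) ^ (a - 1) * (-2 * x)) x := by
  have h0 : 0 < 1 - x ^ 2 := by nlinarith [hx.1, hx.2]
  have h1 : HasDerivAt (fun y : ℝ => (1 - y ^ 2) ^ a) (a * (1 - x ^ 2) ^ (a - 1) * (-2 * x)) x := by
    have h2 : HasDerivAt (fun y : ℝ => 1 - y ^ 2) (-2 * x) x := by
      have := (hasDerivAt_pow 2 x).const_sub 1
      simpa using this
    have := h2.rpow_const (p := a) (Or.inl h0.ne')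
    convert! this using 1
    ring
  refine h1.congr_of_eventuallyEq ?_
  filter_upwards [isOpen_Ioo.mem_nhds hx] with y hy
  exact truncPow_of_abs_le (abs_le.2 ⟨hy.1.le, hy.2.le⟩)

/-- `truncPow a` has a Lipschitz derivative near each point of `(-1, 1)`. -/
theorem exists_lipschitz_deriv_truncPow (a : ℝ) {x₀ r : ℝ}
    (hsub : Metric.closedBall x₀ r ⊆ Ioo (-1 : ℝ) 1) :
    ∃ L, ∀ x ∈ Metric.ball x₀ r, ∀ y ∈ Metric.ball x₀ r,
      |a * (1 - x ^ 2) ^ (a - 1) * (-2 * x) - a * (1 - y ^ 2) ^ (a - 1) * (-2 * y)| ≤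
        L * |x - y| := by
  have hc : ContDiffOn ℝ 1 (fun x : ℝ => a * (1 - x ^ 2) ^ (a - 1) * (-2 * x))
      (Metric.closedBall x₀ r) := by
    intro x hx
    have h0 : 1 - x ^ 2 ≠ 0 := by have := hsub hx; nlinarith [this.1, this.2]
    apply ContDiffAt.contDiffWithinAt
    exact (contDiffAt_const.mul ((contDiffAt_const.sub (contDiffAt_id.pow 2)).rpow_const_of_ne
      h0)).mul (contDiffAt_const.mul contDiffAt_id)
  obtain ⟨K, hK⟩ := hc.exists_lipschitzOnWith one_ne_zero (convex_closedBall _ _)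
    (isCompact_closedBall _ _)
  refine ⟨K, fun x hx y hy => ?_⟩
  have := hK.dist_le_mul x (Metric.ball_subset_closedBall hx) y (Metric.ball_subset_closedBall hy)
  simpa only [Real.dist_eq] using this

/-- A ball around a point of `(-1, 1)` whose double stays in `(-1, 1)`. -/
theorem exists_closedBall_subset_Ioo {x₀ : ℝ} (hx : x₀ ∈ Ioo (-1 : ℝ) 1) :
    ∃ r > 0, Metric.closedBall x₀ (2 * r) ⊆ Ioo (-1 : ℝ) 1 := by
  obtain ⟨r, hr, h⟩ := Metric.nhds_basis_closedBall.mem_iff.1 (isOpen_Ioo.mem_nhds hx)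
  exact ⟨r / 2, by positivity, by rwa [mul_div_cancel₀ _ two_ne_zero]⟩

theorem exists_abs_levyIntegrand_truncPow_le (α : ℝ) {a x₀ : ℝ} (ha : 0 < a)
    (hx : x₀ ∈ Ioo (-1 : ℝ) 1) :
    ∃ r > 0, ∃ C, ∀ x ∈ Metric.ball x₀ r, ∀ z,
      |levyIntegrand α (truncPow a) x z| ≤ C * (min (z ^ 2) 1 / |z| ^ (1 + α)) := by
  obtain ⟨r, hr, hsub⟩ := exists_closedBall_subset_Ioo hx
  obtain ⟨L, hL⟩ := exists_lipschitz_deriv_truncPow a hsub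
  refine ⟨r, hr, exists_abs_levyIntegrand_le (M := 1) α hr (fun x => ?_)
    (fun x hx => hasDerivAt_truncPow (hsub (Metric.ball_subset_closedBall hx))) hL⟩
  rw [abs_of_nonneg (truncPow_nonneg a x)]
  exact truncPow_le_one ha x

theorem integrable_levyIntegrand_truncPow {α a x : ℝ} (hα : α ∈ Ioo (0 : ℝ) 2) (ha : 0 < a)
    (hx : x ∈ Ioo (-1 : ℝ) 1) : Integrable (levyIntegrand α (truncPow a) x) := by
  obtain ⟨r, hr, C, hC⟩ := exists_abs_levyIntegrand_truncPow_le α ha hx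
  exact integrable_levyIntegrand hα (continuous_truncPow ha) (hC x (Metric.mem_ball_self hr))

/-! ### The beta integral -/

/-- Euler's integral for `Γ(1 - a) Γ(a)`, in the form that is integrated over a half-line. -/
theorem integral_rpow_neg_div_one_add {a : ℝ} (ha : a ∈ Ioo (0 : ℝ) 1) :
    IntegrableOn (fun t : ℝ => t ^ (-a) / (1 + t)) (Ioi 0) ∧
    ∫ t in Ioi (0 : ℝ), t ^ (-a) / (1 + t) = Real.Gamma (1 - a) * Real.Gamma a := by
  have himg : (fun s : ℝ => s / (1 - s)) '' Ioo 0 1 = Ioi 0 := by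
    ext t
    constructor
    · rintro ⟨s, hs, rfl⟩
      exact div_pos hs.1 (by linarith [hs.2])
    · intro ht
      have ht : 0 < t := ht
      refine ⟨t / (1 + t), ⟨by positivity, by rw [div_lt_one (by positivity)]; linarith⟩, ?_⟩
      have h : 1 - t / (1 + t) = 1 / (1 + t) := by field_simp; ring
      simp only [h]
      field_simp
  have hder : ∀ s ∈ Ioo (0 : ℝ) 1,
      HasDerivWithinAt (fun s : ℝ => s / (1 - s)) (1 / (1 - s) ^ 2) (Ioo 0 1) s := by
    intro s hs
    have h1 : (1 - s) ≠ 0 := by linarith [hs.2]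
    have := (hasDerivAt_id s).div ((hasDerivAt_id s).const_sub 1) h1
    refine (this.congr_deriv ?_).hasDerivWithinAt
    simp
  have hmono : MonotoneOn (fun s : ℝ => s / (1 - s)) (Ioo 0 1) := by
    intro s hs t ht hst
    have h1 : 0 < 1 - s := by linarith [hs.2]
    have h2 : 0 < 1 - t := by linarith [ht.2]
    simp only
    rw [div_le_div_iff₀ h1 h2]
    nlinarith
  have hfun : ∀ s ∈ Ioo (0 : ℝ) 1, s ^ (-a) * (1 - s) ^ (a - 1) =
      (1 / (1 - s) ^ 2) • ((s / (1 - s)) ^ (-a) / (1 + s / (1 - s))) := by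
    intro s hs
    have h1 : 0 < 1 - s := by linarith [hs.2]
    have h2 : 1 + s / (1 - s) = 1 / (1 - s) := by field_simp; ring
    rw [h2, Real.div_rpow hs.1.le h1.le, Real.rpow_neg h1.le, Real.rpow_sub h1, Real.rpow_one,
      smul_eq_mul]
    field_simp
  have hre : (0 : ℝ) < ((1 - a : ℝ) : ℂ).re := by rw [Complex.ofReal_re]; linarith [ha.2]
  have hre2 : (0 : ℝ) < ((a : ℝ) : ℂ).re := by rw [Complex.ofReal_re]; exact ha.1
  have hcast : ∀ s ∈ Ioo (0 : ℝ) 1,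
      (s : ℂ) ^ (((1 - a : ℝ) : ℂ) - 1) * (1 - (s : ℂ)) ^ (((a : ℝ) : ℂ) - 1) =
        ((s ^ (-a) * (1 - s) ^ (a - 1) : ℝ) : ℂ) := by
    intro s hs
    have h1 : 0 < 1 - s := by linarith [hs.2]
    rw [Complex.ofReal_mul, Complex.ofReal_cpow hs.1.le, Complex.ofReal_cpow h1.le]
    push_cast
    congr 2
    ring
  have hconv := Complex.betaIntegral_convergent hre hre2
  rw [intervalIntegrable_iff_integrableOn_Ioo_of_le zero_le_one] at hconv
  have hint : IntegrableOn (fun s : ℝ => s ^ (-a) * (1 - s) ^ (a - 1)) (Ioo 0 1) := by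
    have h : Integrable (fun s : ℝ => ((s ^ (-a) * (1 - s) ^ (a - 1) : ℝ) : ℂ))
      (volume.restrict (Ioo 0 1)) := hconv.congr_fun hcast measurableSet_Ioo
    exact h.re
  have hval : ∫ s in Ioo (0 : ℝ) 1, s ^ (-a) * (1 - s) ^ (a - 1) =
      Real.Gamma (1 - a) * Real.Gamma a := by
    have h1 := Complex.Gamma_mul_Gamma_eq_betaIntegral hre hre2
    rw [Complex.betaIntegral, intervalIntegral.integral_of_le zero_le_one,
      integral_Ioc_eq_integral_Ioo, setIntegral_congr_fun measurableSet_Ioo hcast,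
      integral_complex_ofReal, ← Complex.ofReal_add, sub_add_cancel] at h1
    simp only [Complex.Gamma_ofReal, Real.Gamma_one] at h1
    norm_cast at h1
    rw [h1, one_mul]
  rw [← himg]
  constructor
  · rw [integrableOn_image_iff_integrableOn_deriv_smul_of_monotoneOn measurableSet_Ioo hder hmono]
    exact hint.congr_fun hfun measurableSet_Ioo
  · rw [integral_image_eq_integral_deriv_smul_of_monotoneOn measurableSet_Ioo hder hmono, ← hval]
    exact (setIntegral_congr_fun measurableSet_Ioo hfun).symm

theorem integral_rpow_neg_div_one_add_mul {a b : ℝ} (ha : a ∈ Ioo (0 : ℝ) 1) (hb : 0 < b) :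
    IntegrableOn (fun t : ℝ => t ^ (-a) / (1 + b * t)) (Ioi 0) ∧
    ∫ t in Ioi (0 : ℝ), t ^ (-a) / (1 + b * t) =
      b ^ (a - 1) * (Real.Gamma (1 - a) * Real.Gamma a) := by
  obtain ⟨h1, h2⟩ := integral_rpow_neg_div_one_add ha
  have hfun : ∀ t ∈ Ioi (0 : ℝ), b ^ a * ((b * t) ^ (-a) / (1 + b * t)) =
      t ^ (-a) / (1 + b * t) := by
    intro t ht
    rw [Real.mul_rpow hb.le (le_of_lt ht), Real.rpow_neg hb.le]
    have : b ^ a ≠ 0 := by positivity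
    field_simp
  constructor
  · have h3 := (integrableOn_Ioi_comp_mul_left_iff
      (fun t : ℝ => t ^ (-a) / (1 + t)) 0 hb).2 (by rwa [mul_zero])
    exact IntegrableOn.congr_fun (h3.const_mul (b ^ a)) hfun measurableSet_Ioi
  · rw [← setIntegral_congr_fun measurableSet_Ioi hfun, integral_const_mul,
      integral_comp_mul_left_Ioi (fun t : ℝ => t ^ (-a) / (1 + t)) 0 hb, mul_zero, h2,
      Real.rpow_sub hb, Real.rpow_one, smul_eq_mul]
    field_simp

/-! ### The Möbius substitution -/

/-- The displacement `y - x` of the image `y = (x + w) / (1 + x * w)` of `w` under the Möbius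
automorphism of `(-1, 1)` that maps `0` to `x`. -/
noncomputable def moebiusShift (x w : ℝ) : ℝ := w * (1 - x ^ 2) / (1 + x * w)

theorem one_add_mul_pos {x w : ℝ} (hx : x ∈ Ioo (-1 : ℝ) 1) (hw : w ∈ Icc (0 : ℝ) 1) :
    0 < 1 + x * w := by
  nlinarith [hx.1, hx.2, hw.1, hw.2]

theorem one_sub_sq_pos {x : ℝ} (hx : x ∈ Ioo (-1 : ℝ) 1) : 0 < 1 - x ^ 2 := by
  nlinarith [hx.1, hx.2]

theorem moebiusShift_one {x : ℝ} (hx : x ∈ Ioo (-1 : ℝ) 1) : moebiusShift x 1 = 1 - x := by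
  have : 1 + x ≠ 0 := by linarith [hx.1]
  rw [moebiusShift]
  field_simp
  ring

theorem moebiusShift_pos {x w : ℝ} (hx : x ∈ Ioo (-1 : ℝ) 1) (hw : w ∈ Ioc (0 : ℝ) 1) :
    0 < moebiusShift x w :=
  div_pos (mul_pos hw.1 (one_sub_sq_pos hx)) (one_add_mul_pos hx ⟨hw.1.le, hw.2⟩)

theorem hasDerivAt_moebiusShift {x w : ℝ} (hx : x ∈ Ioo (-1 : ℝ) 1) (hw : w ∈ Icc (0 : ℝ) 1) :
    HasDerivAt (moebiusShift x) ((1 - x ^ 2) / (1 + x * w) ^ 2) w := by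
  have h := (one_add_mul_pos hx hw).ne'
  have := ((hasDerivAt_id w).mul_const (1 - x ^ 2)).div
    (((hasDerivAt_id w).const_mul x).const_add 1) h
  refine this.congr_deriv ?_
  simp only [id]
  congr 1
  ring

theorem one_sub_sq_add_moebiusShift {x w : ℝ} (hx : x ∈ Ioo (-1 : ℝ) 1)
    (hw : w ∈ Icc (0 : ℝ) 1) : 1 - (x + moebiusShift x w) ^ 2 =
      (1 - x ^ 2) * (1 - w ^ 2) / (1 + x * w) ^ 2 := by
  have h := (one_add_mul_pos hx hw).ne'
  rw [moebiusShift]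
  field_simp
  ring

theorem abs_add_moebiusShift_le {x w : ℝ} (hx : x ∈ Ioo (-1 : ℝ) 1)
    (hw : w ∈ Icc (0 : ℝ) 1) : |x + moebiusShift x w| ≤ 1 := by
  rw [← sq_le_one_iff_abs_le_one, ← sub_nonneg, one_sub_sq_add_moebiusShift hx hw]
  have h1 := one_sub_sq_pos hx
  have h2 : 0 ≤ 1 - w ^ 2 := by nlinarith [hw.1, hw.2]
  positivity

/-- The substitution of the Möbius coordinate, for displacements to the right of `x`. -/
theorem setIntegral_truncPow_mul_rpow {a x ε : ℝ} (ha : a ∈ Ioo (0 : ℝ) 1)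
    (hx : x ∈ Ioo (-1 : ℝ) 1) (hε : ε ∈ Ioo (0 : ℝ) 1) :
    ∫ z in Ioi (moebiusShift x ε), truncPow a (x + z) * z ^ (-(1 + 2 * a)) =
      (1 - x ^ 2) ^ (-a) *
        ∫ w in Icc ε 1, (1 - w ^ 2) ^ a / (1 + x * w) * w ^ (-(1 + 2 * a)) := by
  have hb := one_sub_sq_pos hx
  have hδ := moebiusShift_pos hx ⟨hε.1, hε.2.le⟩
  have h1 : ∫ z in Ioi (moebiusShift x ε), truncPow a (x + z) * z ^ (-(1 + 2 * a)) =
      ∫ z in Icc (moebiusShift x ε) (moebiusShift x 1),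
        truncPow a (x + z) * z ^ (-(1 + 2 * a)) := by
    rw [← integral_Ici_eq_integral_Ioi]
    refine setIntegral_eq_of_subset_of_forall_sdiff_eq_zero measurableSet_Ici
      Icc_subset_Ici_self fun z hz => ?_
    have hz1 : moebiusShift x 1 < z := by
      by_contra! hcon
      exact hz.2 ⟨hz.1, hcon⟩
    rw [moebiusShift_one hx] at hz1
    rw [truncPow_of_one_le_abs ha.1 (le_abs.2 (Or.inl (by linarith))), zero_mul]
  have hmem : ∀ w ∈ Icc ε 1, w ∈ Icc (0 : ℝ) 1 := fun w hw => ⟨hε.1.le.trans hw.1, hw.2⟩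
  rw [h1, ← integral_Icc_deriv_smul_of_deriv_nonneg
    (f' := fun w => (1 - x ^ 2) / (1 + x * w) ^ 2)
    (fun w hw => (hasDerivAt_moebiusShift hx (hmem w hw)).continuousAt.continuousWithinAt)
    (fun w hw => hasDerivAt_moebiusShift hx (hmem w (Ioo_subset_Icc_self hw)))
    (fun w hw => by positivity) hε.2.le, ← integral_const_mul]
  refine setIntegral_congr_fun measurableSet_Icc fun w hw => ?_
  have hw0 : 0 < w := hε.1.trans_le hw.1
  have h2 : 0 ≤ 1 - w ^ 2 := by nlinarith [hw.2]
  have h3 := one_add_mul_pos hx (hmem w hw)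
  simp only [smul_eq_mul]
  rw [truncPow_of_abs_le (abs_add_moebiusShift_le hx (hmem w hw)),
    one_sub_sq_add_moebiusShift hx (hmem w hw), moebiusShift,
    Real.div_rpow (by positivity) (by positivity), Real.mul_rpow hb.le h2,
    Real.div_rpow (by positivity) h3.le, Real.mul_rpow hw0.le hb.le,
    ← Real.rpow_natCast (1 + x * w) 2, ← Real.rpow_mul h3.le]
  set B := 1 - x ^ 2
  set q := 1 + x * w
  have h4 : B ^ (-a) = B * B ^ a * B ^ (-(1 + 2 * a)) := by
    nth_rewrite 2 [← Real.rpow_one B]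
    rw [← Real.rpow_add hb, ← Real.rpow_add hb]
    congr 1
    ring
  have h5 : q ^ (((2 : ℕ) : ℝ) * a) * q ^ (-(1 + 2 * a)) = q⁻¹ := by
    rw [← Real.rpow_add h3, ← Real.rpow_neg_one]
    congr 1
    push_cast
    ring
  have h6 : q ^ (((2 : ℕ) : ℝ)) = q ^ 2 := Real.rpow_natCast q 2
  have h7 : q ^ (-(1 + 2 * a)) = q⁻¹ / q ^ (((2 : ℕ) : ℝ) * a) := by
    rw [← h5]; field_simp
  rw [h4, h7, h6]
  field_simp

/-- The Lévy–Khintchine integral over displacements to the right of `x`, cut off at `w = ε`. The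
restriction `ε ≤ 1 / 2` keeps the cutoff below the radius `1` of the compensator. -/
theorem setIntegral_levyIntegrand_truncPow {a x ε : ℝ} (ha : a ∈ Ioo (0 : ℝ) 1)
    (hx : x ∈ Ioo (-1 : ℝ) 1) (hε : ε ∈ Ioc (0 : ℝ) (1 / 2)) :
    ∫ z in Ioi (moebiusShift x ε), levyIntegrand (2 * a) (truncPow a) x z =
      (1 - x ^ 2) ^ (-a) *
        ((∫ w in Icc ε 1, (1 - w ^ 2) ^ a / (1 + x * w) * w ^ (-(1 + 2 * a))) -
          ε ^ (-(2 * a)) * (1 + x * ε) ^ (2 * a) / (2 * a)) -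
      deriv (truncPow a) x * ∫ z in (moebiusShift x ε)..1, z ^ (-(2 * a)) := by
  have hε1 : ε ∈ Ioo (0 : ℝ) 1 := ⟨hε.1, by linarith [hε.2]⟩
  have hb := one_sub_sq_pos hx
  have hq := one_add_mul_pos hx ⟨hε1.1.le, hε1.2.le⟩
  have hδ := moebiusShift_pos hx ⟨hε1.1, hε1.2.le⟩
  have hδ1 : moebiusShift x ε ≤ 1 := by
    rw [moebiusShift, div_le_one hq]
    nlinarith [hε.1, hε.2, hx.1, hx.2, sq_nonneg (x + 1 / 2)]
  set δ := moebiusShift x ε with hδdef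
  have hpow : IntegrableOn (fun z : ℝ => z ^ (-(1 + 2 * a))) (Ioi δ) :=
    (integrableOn_Ioi_rpow_iff hδ).2 (by linarith [ha.1])
  have hi1 : IntegrableOn (fun z : ℝ => truncPow a (x + z) * z ^ (-(1 + 2 * a))) (Ioi δ) := by
    refine Integrable.mono' hpow ?_ ?_
    · exact (((continuous_truncPow ha.1).comp (continuous_const.add continuous_id)).measurable.mul
        (by fun_prop)).aestronglyMeasurable
    · filter_upwards [ae_restrict_mem measurableSet_Ioi] with z hz
      have hz0 : 0 < z := hδ.trans hz
      rw [Real.norm_of_nonneg (mul_nonneg (truncPow_nonneg _ _) (by positivity))]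
      exact mul_le_of_le_one_left (by positivity) (truncPow_le_one ha.1 _)
  have hi2 : IntegrableOn (fun z : ℝ => truncPow a x * z ^ (-(1 + 2 * a))) (Ioi δ) :=
    hpow.const_mul _
  have hi3' : IntegrableOn (fun z : ℝ => z ^ (-(2 * a))) (Ioc δ 1) := by
    refine (ContinuousOn.integrableOn_Icc fun z hz => ?_).mono_set Ioc_subset_Icc_self
    exact (Real.continuousAt_rpow_const _ _
      (Or.inl (hδ.trans_le hz.1).ne')).continuousWithinAt
  have hi3 : IntegrableOn ((Ioc δ 1).indicator fun z : ℝ =>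
      deriv (truncPow a) x * z ^ (-(2 * a))) (Ioi δ) :=
    ((integrable_indicator_iff measurableSet_Ioc).2 (hi3'.const_mul _)).integrableOn
  have hi12 : IntegrableOn (fun z : ℝ => truncPow a (x + z) * z ^ (-(1 + 2 * a)) -
      truncPow a x * z ^ (-(1 + 2 * a))) (Ioi δ) := hi1.sub hi2
  have hfun : ∀ z ∈ Ioi δ, levyIntegrand (2 * a) (truncPow a) x z =
      truncPow a (x + z) * z ^ (-(1 + 2 * a)) - truncPow a x * z ^ (-(1 + 2 * a)) -
        (Ioc δ 1).indicator (fun z : ℝ => deriv (truncPow a) x * z ^ (-(2 * a))) z := by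
    intro z hz
    have hz0 : 0 < z := hδ.trans hz
    have h1 : z ^ (-(2 * a)) = z * z ^ (-(1 + 2 * a)) := by
      nth_rewrite 2 [← Real.rpow_one z]
      rw [← Real.rpow_add hz0]
      congr 1
      ring
    rw [levyIntegrand, abs_of_pos hz0, div_eq_mul_inv, ← Real.rpow_neg hz0.le, sub_mul, sub_mul]
    congr 1
    by_cases hz1 : z ≤ 1
    · have hz2 : z ∈ Ioc δ 1 := ⟨hz, hz1⟩
      rw [if_pos hz1, indicator_of_mem hz2, h1]
      ring
    · rw [if_neg hz1, indicator_of_notMem (fun h => hz1 h.2), zero_mul]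
  rw [setIntegral_congr_fun measurableSet_Ioi hfun, integral_sub hi12 hi3,
    integral_sub hi1 hi2, integral_const_mul, integral_Ioi_rpow_of_lt (by linarith [ha.1]) hδ,
    setIntegral_truncPow_mul_rpow ha hx hε1, setIntegral_indicator measurableSet_Ioc,
    inter_eq_self_of_subset_right Ioc_subset_Ioi_self, integral_const_mul,
    intervalIntegral.integral_of_le hδ1]
  congr 1
  rw [mul_sub]
  congr 1
  have hxa : |x| ≤ 1 := abs_le.2 ⟨hx.1.le, hx.2.le⟩
  have e1 : -(1 + 2 * a) + 1 = -(2 * a) := by ring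
  have ha0 := ha.1.ne'
  rw [truncPow_of_abs_le hxa, e1, hδdef, moebiusShift, Real.div_rpow (by positivity [hε.1]) hq.le,
    Real.mul_rpow hε.1.le hb.le, Real.rpow_neg hq.le]
  have h4 : (1 - x ^ 2) ^ (-a) = (1 - x ^ 2) ^ a * (1 - x ^ 2) ^ (-(2 * a)) := by
    rw [← Real.rpow_add hb]
    congr 1
    ring
  rw [h4]
  field_simp

/-! ### The substitution `t = w² / (1 - w²)` -/

/-- Separation of the part that diverges as `T` tends to `0`. -/
theorem setIntegral_rpow_neg_div {a b T : ℝ} (ha : a ∈ Ioo (0 : ℝ) 1) (hb : 0 < b)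
    (hT : 0 < T) :
    ∫ t in Ioi T, t ^ (-(1 + a)) / (1 + b * t) =
      T ^ (-a) / a - b * ∫ t in Ioi T, t ^ (-a) / (1 + b * t) := by
  have hi1 : IntegrableOn (fun t : ℝ => t ^ (-(1 + a))) (Ioi T) :=
    (integrableOn_Ioi_rpow_iff hT).2 (by linarith [ha.1])
  have hi2 : IntegrableOn (fun t : ℝ => t ^ (-a) / (1 + b * t)) (Ioi T) :=
    (integral_rpow_neg_div_one_add_mul ha hb).1.mono_set (Ioi_subset_Ioi hT.le)
  have hfun : ∀ t ∈ Ioi T, t ^ (-(1 + a)) / (1 + b * t) =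
      t ^ (-(1 + a)) - b * (t ^ (-a) / (1 + b * t)) := by
    intro t ht
    have ht0 : 0 < t := hT.trans ht
    have h1 : t ^ (-a) = t * t ^ (-(1 + a)) := by
      nth_rewrite 2 [← Real.rpow_one t]
      rw [← Real.rpow_add ht0]
      congr 1
      ring
    rw [h1]
    field_simp
    ring
  rw [setIntegral_congr_fun measurableSet_Ioi hfun, integral_sub hi1 (hi2.const_mul b),
    integral_const_mul, integral_Ioi_rpow_of_lt (by linarith [ha.1]) hT]
  congr 1
  have e1 : -(1 + a) + 1 = -a := by ring
  rw [e1, neg_div_neg_eq]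

/-- The substitution `t = w² / (1 - w²)`. -/
theorem setIntegral_one_sub_sq_rpow {a x ε : ℝ} (hx : x ∈ Ioo (-1 : ℝ) 1)
    (hε : ε ∈ Ioo (0 : ℝ) 1) :
    ∫ w in Ioo ε 1, 2 * (1 - w ^ 2) ^ a / (1 - x ^ 2 * w ^ 2) * w ^ (-(1 + 2 * a)) =
      ∫ t in Ioi (ε ^ 2 / (1 - ε ^ 2)), t ^ (-(1 + a)) / (1 + (1 - x ^ 2) * t) := by
  have hpos : ∀ w ∈ Ioo ε 1, 0 < 1 - w ^ 2 := fun w hw => by nlinarith [hε.1, hw.1, hw.2]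
  have hε2 : 0 < 1 - ε ^ 2 := by nlinarith [hε.1, hε.2]
  have himg : (fun w : ℝ => w ^ 2 / (1 - w ^ 2)) '' Ioo ε 1 = Ioi (ε ^ 2 / (1 - ε ^ 2)) := by
    ext t
    constructor
    · rintro ⟨w, hw, rfl⟩
      rw [mem_Ioi, div_lt_div_iff₀ hε2 (hpos w hw)]
      nlinarith [hε.1, hw.1]
    · intro ht
      have ht : ε ^ 2 / (1 - ε ^ 2) < t := ht
      have ht0 : 0 < t := lt_trans (div_pos (pow_pos hε.1 2) hε2) ht
      have hs : √(t / (1 + t)) ^ 2 = t / (1 + t) := Real.sq_sqrt (by positivity)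
      refine ⟨√(t / (1 + t)), ⟨?_, ?_⟩, ?_⟩
      · apply Real.lt_sqrt_of_sq_lt
        rw [lt_div_iff₀ (by positivity)]
        rw [div_lt_iff₀ hε2] at ht
        linarith
      · rw [Real.sqrt_lt' one_pos, div_lt_iff₀ (by positivity)]
        linarith
      · simp only [hs]
        have h : 1 - t / (1 + t) = 1 / (1 + t) := by field_simp; ring
        rw [h]
        field_simp
  have hder : ∀ w ∈ Ioo ε 1, HasDerivWithinAt (fun w : ℝ => w ^ 2 / (1 - w ^ 2))
      (2 * w / (1 - w ^ 2) ^ 2) (Ioo ε 1) w := by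
    intro w hw
    have := (hasDerivAt_pow 2 w).div ((hasDerivAt_pow 2 w).const_sub 1) (hpos w hw).ne'
    refine (this.congr_deriv ?_).hasDerivWithinAt
    congr 1
    simp
    ring
  have hmono : MonotoneOn (fun w : ℝ => w ^ 2 / (1 - w ^ 2)) (Ioo ε 1) := by
    intro s hs t ht hst
    simp only
    rw [div_le_div_iff₀ (hpos s hs) (hpos t ht)]
    nlinarith [hε.1, hs.1]
  rw [← himg, integral_image_eq_integral_deriv_smul_of_monotoneOn measurableSet_Ioo hder hmono]
  refine setIntegral_congr_fun measurableSet_Ioo fun w hw => ?_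
  have hw0 : 0 < w := hε.1.trans hw.1
  have hq := hpos w hw
  have h1 : 0 < 1 - x ^ 2 * w ^ 2 := by nlinarith [one_sub_sq_pos hx, sq_nonneg x]
  have h2 : 1 + (1 - x ^ 2) * (w ^ 2 / (1 - w ^ 2)) = (1 - x ^ 2 * w ^ 2) / (1 - w ^ 2) := by
    field_simp
    ring
  simp only [smul_eq_mul]
  rw [h2, Real.div_rpow (by positivity) hq.le, Real.rpow_neg hq.le, Real.rpow_add hq,
    Real.rpow_one, ← Real.rpow_natCast w 2, ← Real.rpow_mul hw0.le]
  have h3 : w ^ (((2 : ℕ) : ℝ) * -(1 + a)) = w ^ (-(1 + 2 * a)) / w := by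
    nth_rewrite 3 [← Real.rpow_one w]
    rw [← Real.rpow_sub hw0]
    congr 1
    push_cast
    ring
  rw [h3, Real.rpow_natCast w 2]
  field_simp

/-- The sum of the contributions from the right and from the left of `x`, the latter being that
from the right of `-x`. -/
theorem setIntegral_add_reflection {a x ε : ℝ} (ha : a ∈ Ioo (0 : ℝ) 1)
    (hx : x ∈ Ioo (-1 : ℝ) 1) (hε : ε ∈ Ioo (0 : ℝ) 1) :
    (∫ w in Icc ε 1, (1 - w ^ 2) ^ a / (1 + x * w) * w ^ (-(1 + 2 * a))) +
      (∫ w in Icc ε 1, (1 - w ^ 2) ^ a / (1 + -x * w) * w ^ (-(1 + 2 * a))) =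
      ∫ t in Ioi (ε ^ 2 / (1 - ε ^ 2)), t ^ (-(1 + a)) / (1 + (1 - x ^ 2) * t) := by
  have hint : ∀ y ∈ Ioo (-1 : ℝ) 1, IntegrableOn
      (fun w : ℝ => (1 - w ^ 2) ^ a / (1 + y * w) * w ^ (-(1 + 2 * a))) (Icc ε 1) := by
    intro y hy
    refine ContinuousOn.integrableOn_Icc fun w hw => ?_
    have hw0 : 0 < w := hε.1.trans_le hw.1
    apply ContinuousAt.continuousWithinAt
    refine ContinuousAt.mul (ContinuousAt.div ?_ (by fun_prop)
      (one_add_mul_pos hy ⟨hw0.le, hw.2⟩).ne') (Real.continuousAt_rpow_const _ _ (Or.inl hw0.ne'))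
    exact ContinuousAt.rpow_const (by fun_prop) (Or.inr ha.1.le)
  have hx' : -x ∈ Ioo (-1 : ℝ) 1 := ⟨by linarith [hx.2], by linarith [hx.1]⟩
  rw [← integral_add (hint x hx) (hint (-x) hx'), ← setIntegral_one_sub_sq_rpow hx hε,
    integral_Icc_eq_integral_Ioo]
  refine setIntegral_congr_fun measurableSet_Ioo fun w hw => ?_
  have hw0 : w ∈ Icc (0 : ℝ) 1 := ⟨hε.1.le.trans hw.1.le, hw.2.le⟩
  have h1 := one_add_mul_pos hx hw0
  have h2 := one_add_mul_pos hx' hw0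
  have h3 : 1 - x ^ 2 * w ^ 2 = (1 + x * w) * (1 + -x * w) := by ring
  have h4 : (1 + x * w) + (1 + -x * w) = 2 := by ring
  rw [h3]
  generalize 1 + x * w = p at h1 h4 ⊢
  generalize 1 + -x * w = q at h2 h4 ⊢
  rw [← h4]
  field_simp
  ring

theorem levyIntegrand_neg_of_even {α : ℝ} {w : ℝ → ℝ} (hw : ∀ x, w (-x) = w x) (x z : ℝ) :
    levyIntegrand α w x (-z) = levyIntegrand α w (-x) z := by
  have h1 : deriv w (-x) = -deriv w x := by
    have := deriv_comp_neg w x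
    simp only [hw] at this
    linarith
  have h2 : w (x + -z) = w (-x + z) := by rw [← hw]; ring_nf
  rw [levyIntegrand, levyIntegrand, h1, h2, hw, abs_neg]
  split_ifs <;> ring

/-- The Lévy–Khintchine integral of `truncPow a` outside a neighbourhood of the origin that is
symmetric in the Möbius coordinate `w`. -/
theorem setIntegral_levyIntegrand_truncPow_union {a x ε : ℝ} (ha : a ∈ Ioo (0 : ℝ) 1)
    (hx : x ∈ Ioo (-1 : ℝ) 1) (hε : ε ∈ Ioc (0 : ℝ) (1 / 2)) :
    ∫ z in Iic (-moebiusShift (-x) ε) ∪ Ioi (moebiusShift x ε),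
        levyIntegrand (2 * a) (truncPow a) x z =
      (1 - x ^ 2) ^ (-a) * (-((1 - x ^ 2) *
          ∫ t in Ioi (ε ^ 2 / (1 - ε ^ 2)), t ^ (-a) / (1 + (1 - x ^ 2) * t)) +
        ε ^ (-(2 * a)) * ((1 - ε ^ 2) ^ a -
          ((1 + x * ε) ^ (2 * a) + (1 - x * ε) ^ (2 * a)) / 2) / a) -
      deriv (truncPow a) x *
        ∫ z in (moebiusShift x ε)..(moebiusShift (-x) ε), z ^ (-(2 * a)) := by
  have hε1 : ε ∈ Ioo (0 : ℝ) 1 := ⟨hε.1, by linarith [hε.2]⟩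
  have hε2 : 0 < 1 - ε ^ 2 := by nlinarith [hε1.1, hε1.2]
  have hx' : -x ∈ Ioo (-1 : ℝ) 1 := ⟨by linarith [hx.2], by linarith [hx.1]⟩
  have hδ := moebiusShift_pos hx ⟨hε1.1, hε1.2.le⟩
  have hδ' := moebiusShift_pos hx' ⟨hε1.1, hε1.2.le⟩
  have hint := integrable_levyIntegrand_truncPow (α := 2 * a) (a := a)
    ⟨by linarith [ha.1], by linarith [ha.2]⟩ ha.1 hx
  have hder : deriv (truncPow a) (-x) = -deriv (truncPow a) x := by
    have := deriv_comp_neg (truncPow a) x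
    simp only [truncPow_neg] at this
    linarith
  have hii : ∀ c > 0, IntervalIntegrable (fun z : ℝ => z ^ (-(2 * a))) volume c 1 := fun c hc =>
    intervalIntegral.intervalIntegrable_rpow (Or.inr (notMem_uIcc_of_lt hc one_pos))
  have hcomp : (∫ z in (moebiusShift x ε)..1, z ^ (-(2 * a))) -
      (∫ z in (moebiusShift (-x) ε)..1, z ^ (-(2 * a))) =
      ∫ z in (moebiusShift x ε)..(moebiusShift (-x) ε), z ^ (-(2 * a)) := by
    rw [sub_eq_iff_eq_add]
    exact (intervalIntegral.integral_add_adjacent_intervals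
      ((hii _ hδ).trans (hii _ hδ').symm) (hii _ hδ')).symm
  have hdisj : Disjoint (Iic (-moebiusShift (-x) ε)) (Ioi (moebiusShift x ε)) :=
    Iic_disjoint_Ioi (by linarith)
  have hT : (ε ^ 2 / (1 - ε ^ 2)) ^ (-a) = ε ^ (-(2 * a)) * (1 - ε ^ 2) ^ a := by
    rw [Real.div_rpow (by positivity) hε2.le, Real.rpow_neg hε2.le, ← Real.rpow_natCast ε 2,
      ← Real.rpow_mul hε1.1.le, div_inv_eq_mul]
    congr 2
    push_cast
    ring
  rw [setIntegral_union hdisj measurableSet_Ioi hint.integrableOn hint.integrableOn,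
    ← integral_comp_neg_Ioi]
  simp only [levyIntegrand_neg_of_even (truncPow_neg a)]
  have hJ := setIntegral_add_reflection ha hx hε1
  rw [setIntegral_rpow_neg_div ha (one_sub_sq_pos hx)
    (div_pos (pow_pos hε1.1 2) hε2), hT] at hJ
  rw [setIntegral_levyIntegrand_truncPow ha hx hε, setIntegral_levyIntegrand_truncPow ha hx' hε,
    hder, neg_sq, ← hcomp, sub_eq_add_neg 1 (x * ε), ← neg_mul]
  have hJ' := eq_sub_of_add_eq' hJ
  rw [hJ']
  have ha0 := ha.1.ne'
  field_simp
  ring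

/-- The second difference of `s ↦ s ^ (2 * a)` is quadratically small: the arithmetic–geometric
mean inequality bounds it from below, Bernoulli's inequality for `((1 ± x * ε) ^ 2) ^ a` from
above. -/
theorem abs_one_sub_sq_rpow_sub_le {a x ε : ℝ} (ha : a ∈ Ioo (0 : ℝ) 1)
    (hx : x ∈ Ioo (-1 : ℝ) 1) (hε : ε ∈ Ioo (0 : ℝ) 1) :
    |(1 - ε ^ 2) ^ a - ((1 + x * ε) ^ (2 * a) + (1 - x * ε) ^ (2 * a)) / 2| ≤ 2 * ε ^ 2 := by
  have hx' : -x ∈ Ioo (-1 : ℝ) 1 := ⟨by linarith [hx.2], by linarith [hx.1]⟩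
  have h1 := one_add_mul_pos hx ⟨hε.1.le, hε.2.le⟩
  have h2 : 0 < 1 - x * ε := by have := one_add_mul_pos hx' ⟨hε.1.le, hε.2.le⟩; linarith
  have hx2 := one_sub_sq_pos hx
  have hε2 : ε ^ 2 ≤ 1 := by nlinarith [hε.1, hε.2]
  set s := x * ε with hs
  have hs2 : s ^ 2 ≤ ε ^ 2 := by rw [hs]; nlinarith [sq_nonneg ε]
  have hlow : 1 - ε ^ 2 ≤ (1 - ε ^ 2) ^ a :=
    Real.self_le_rpow_of_le_one (by linarith) (by linarith [sq_nonneg ε]) ha.2.le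
  have hle : (1 - ε ^ 2) ^ a ≤ ((1 + s) ^ (2 * a) + (1 - s) ^ (2 * a)) / 2 := by
    have e1 : (1 + s) ^ (2 * a) = ((1 + s) ^ a) ^ 2 := by
      rw [mul_comm 2 a, Real.rpow_mul h1.le, Real.rpow_two]
    have e2 : (1 - s) ^ (2 * a) = ((1 - s) ^ a) ^ 2 := by
      rw [mul_comm 2 a, Real.rpow_mul h2.le, Real.rpow_two]
    calc (1 - ε ^ 2) ^ a ≤ ((1 + s) * (1 - s)) ^ a :=
          Real.rpow_le_rpow (by linarith) (by linarith) ha.1.le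
      _ = (1 + s) ^ a * (1 - s) ^ a := Real.mul_rpow h1.le h2.le
      _ ≤ _ := by
        rw [e1, e2]
        nlinarith [sq_nonneg ((1 + s) ^ a - (1 - s) ^ a)]
  have hbern : ∀ t : ℝ, 0 < 1 + t → (1 + t) ^ (2 * a) ≤ 1 + a * (2 * t + t ^ 2) := by
    intro t ht
    have e : (1 + t) ^ (2 * a) = (1 + (2 * t + t ^ 2)) ^ a := by
      rw [Real.rpow_mul ht.le, Real.rpow_two]
      ring_nf
    rw [e]
    exact rpow_one_add_le_one_add_mul_self (by nlinarith) ha.1.le ha.2.le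
  have hb1 := hbern s h1
  have hb2 := hbern (-s) (by linarith)
  rw [← sub_eq_add_neg] at hb2
  have has : a * s ^ 2 ≤ s ^ 2 := mul_le_of_le_one_left (sq_nonneg s) ha.2.le
  rw [abs_le]
  constructor <;> nlinarith [sq_nonneg ε]

/-! ### The limit, and the equation for Getoor's function -/

theorem tendsto_moebiusShift {x : ℝ} (hx : x ∈ Ioo (-1 : ℝ) 1) :
    Tendsto (moebiusShift x) (𝓝[>] 0) (𝓝 0) := by
  have := (hasDerivAt_moebiusShift hx ⟨le_refl (0 : ℝ), zero_le_one⟩).continuousAt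
  have h0 : moebiusShift x 0 = 0 := by simp [moebiusShift]
  simpa [ContinuousAt, h0] using this.mono_left (nhdsWithin_le_nhds (s := Ioi 0))

theorem tendsto_rpow_nhdsGT_zero {c : ℝ} (hc : 0 < c) :
    Tendsto (fun ε : ℝ => ε ^ c) (𝓝[>] 0) (𝓝 0) := by
  have := (Real.continuousAt_rpow_const 0 c (Or.inr hc.le)).tendsto
  rw [Real.zero_rpow hc.ne'] at this
  exact this.mono_left nhdsWithin_le_nhds

/-- The two half-lengths of the Möbius-symmetric interval differ by `O(ε²)`, so that the
compensator contributes `O(ε ^ (2 - 2 * a))`. -/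
theorem tendsto_integral_moebiusShift {a x : ℝ} (ha : a ∈ Ioo (0 : ℝ) 1)
    (hx : x ∈ Ioo (-1 : ℝ) 1) :
    Tendsto (fun ε => ∫ z in (moebiusShift x ε)..(moebiusShift (-x) ε), z ^ (-(2 * a)))
      (𝓝[>] 0) (𝓝 0) := by
  have hx' : -x ∈ Ioo (-1 : ℝ) 1 := ⟨by linarith [hx.2], by linarith [hx.1]⟩
  have hb := one_sub_sq_pos hx
  set b := 1 - x ^ 2 with hbdef
  have hlim : Tendsto (fun ε : ℝ => (b / 2) ^ (-(2 * a)) * 2 * ε ^ (2 - 2 * a)) (𝓝[>] 0)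
      (𝓝 0) := by
    simpa using (tendsto_rpow_nhdsGT_zero (by linarith [ha.2] : 0 < 2 - 2 * a)).const_mul
      ((b / 2) ^ (-(2 * a)) * 2)
  refine squeeze_zero_norm' ?_ hlim
  filter_upwards [Ioo_mem_nhdsGT (zero_lt_one' ℝ)] with ε hε
  have hε' : ε ∈ Icc (0 : ℝ) 1 := ⟨hε.1.le, hε.2.le⟩
  have hge : ∀ y ∈ Ioo (-1 : ℝ) 1, 1 - y ^ 2 = b → b / 2 * ε ≤ moebiusShift y ε := by
    intro y hy hyb
    have := one_add_mul_pos hy hε'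
    rw [moebiusShift, hyb, le_div_iff₀ this]
    have h2 : 1 + y * ε ≤ 2 := by nlinarith [hy.1, hy.2, hε.1, hε.2]
    nlinarith [mul_pos hb hε.1]
  have h1 := hge x hx rfl
  have h2 := hge (-x) hx' (by rw [neg_sq])
  have hpos : 0 < b / 2 * ε := mul_pos (by positivity) hε.1
  have hbound : ∀ z ∈ uIoc (moebiusShift x ε) (moebiusShift (-x) ε),
      ‖z ^ (-(2 * a))‖ ≤ (b / 2 * ε) ^ (-(2 * a)) := by
    intro z hz
    have hz1 : b / 2 * ε ≤ z := (le_min h1 h2).trans hz.1.le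
    rw [Real.norm_of_nonneg (by have := hpos.trans_le hz1; positivity)]
    exact Real.rpow_le_rpow_of_nonpos hpos hz1 (by linarith [ha.1])
  have hdiff : |moebiusShift (-x) ε - moebiusShift x ε| ≤ 2 * ε ^ 2 := by
    have q1 := one_add_mul_pos hx hε'
    have q2 := one_add_mul_pos hx' hε'
    have e : moebiusShift (-x) ε - moebiusShift x ε =
        2 * ε ^ 2 * (x * (b / ((1 + x * ε) * (1 + -x * ε)))) := by
      rw [moebiusShift, moebiusShift, neg_sq, ← hbdef, div_sub_div _ _ q2.ne' q1.ne']
      ring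
    have hq : b ≤ (1 + x * ε) * (1 + -x * ε) := by
      rw [hbdef]
      nlinarith [sq_nonneg x, hε.1, hε.2, mul_nonneg (sq_nonneg x) (by nlinarith [hε.1, hε.2] :
        (0 : ℝ) ≤ 1 - ε ^ 2)]
    have hfrac : b / ((1 + x * ε) * (1 + -x * ε)) ≤ 1 := (div_le_one (by positivity)).2 hq
    rw [e, abs_mul, abs_of_nonneg (by positivity : 0 ≤ 2 * ε ^ 2)]
    refine mul_le_of_le_one_right (by positivity) ?_
    rw [abs_mul, abs_of_nonneg (by positivity : 0 ≤ b / ((1 + x * ε) * (1 + -x * ε)))]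
    exact mul_le_one₀ (abs_le.2 ⟨hx.1.le, hx.2.le⟩) (by positivity) hfrac
  refine (intervalIntegral.norm_integral_le_of_norm_le_const hbound).trans ?_
  have e : (b / 2 * ε) ^ (-(2 * a)) * (2 * ε ^ 2) =
      (b / 2) ^ (-(2 * a)) * 2 * ε ^ (2 - 2 * a) := by
    rw [Real.mul_rpow (by positivity) hε.1.le, sub_eq_add_neg, Real.rpow_add hε.1, Real.rpow_two]
    ring
  rw [← e]
  gcongr

/-- What is left of the divergent terms after their cancellation tends to zero, since `2 * a < 2`. -/
theorem tendsto_rpow_neg_mul_second_diff {a x : ℝ} (ha : a ∈ Ioo (0 : ℝ) 1)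
    (hx : x ∈ Ioo (-1 : ℝ) 1) :
    Tendsto (fun ε : ℝ => ε ^ (-(2 * a)) * ((1 - ε ^ 2) ^ a -
      ((1 + x * ε) ^ (2 * a) + (1 - x * ε) ^ (2 * a)) / 2) / a) (𝓝[>] 0) (𝓝 0) := by
  have hlim : Tendsto (fun ε : ℝ => 2 / a * ε ^ (2 - 2 * a)) (𝓝[>] 0) (𝓝 0) := by
    simpa using (tendsto_rpow_nhdsGT_zero (by linarith [ha.2] : 0 < 2 - 2 * a)).const_mul (2 / a)
  refine squeeze_zero_norm' ?_ hlim
  filter_upwards [Ioo_mem_nhdsGT (zero_lt_one' ℝ)] with ε hε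
  have ha0 := ha.1
  have hε0 := hε.1
  rw [norm_div, norm_mul, Real.norm_of_nonneg ha0.le, Real.norm_of_nonneg (by positivity),
    Real.norm_eq_abs]
  have e : 2 / a * ε ^ (2 - 2 * a) = ε ^ (-(2 * a)) * (2 * ε ^ 2) / a := by
    rw [sub_eq_add_neg, Real.rpow_add hε.1, Real.rpow_two]
    ring
  rw [e]
  gcongr
  exact abs_one_sub_sq_rpow_sub_le ha hx hε

theorem tendsto_setIntegral_Ioi_nhdsGT {f : ℝ → ℝ} (hf : IntegrableOn f (Ioi 0)) :
    Tendsto (fun ε : ℝ => ∫ t in Ioi (ε ^ 2 / (1 - ε ^ 2)), f t) (𝓝[>] 0)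
      (𝓝 (∫ t in Ioi 0, f t)) := by
  have hT : Tendsto (fun ε : ℝ => ε ^ 2 / (1 - ε ^ 2)) (𝓝[>] 0) (𝓝 0) := by
    have : ContinuousAt (fun ε : ℝ => ε ^ 2 / (1 - ε ^ 2)) 0 :=
      ContinuousAt.div (by fun_prop) (by fun_prop) (by simp)
    simpa [ContinuousAt] using this.mono_left (nhdsWithin_le_nhds (s := Ioi 0))
  have hcov := aecover_Ioi_of_Ioi hT (μ := volume)
  have := hcov.integral_tendsto_of_countably_generated hf
  refine this.congr' ?_
  filter_upwards [Ioo_mem_nhdsGT (zero_lt_one' ℝ)] with ε hε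
  have : 0 ≤ ε ^ 2 / (1 - ε ^ 2) := div_nonneg (sq_nonneg _) (by nlinarith [hε.1, hε.2])
  rw [Measure.restrict_restrict measurableSet_Ioi,
    inter_eq_self_of_subset_left (Ioi_subset_Ioi this)]

/-- The Lévy–Khintchine integral of `truncPow a` does not depend on the point of `(-1, 1)`. -/
theorem integral_levyIntegrand_truncPow {a x : ℝ} (ha : a ∈ Ioo (0 : ℝ) 1)
    (hx : x ∈ Ioo (-1 : ℝ) 1) :
    ∫ z, levyIntegrand (2 * a) (truncPow a) x z = -(Real.Gamma (1 - a) * Real.Gamma a) := by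
  have hx' : -x ∈ Ioo (-1 : ℝ) 1 := ⟨by linarith [hx.2], by linarith [hx.1]⟩
  have hb := one_sub_sq_pos hx
  have hint := integrable_levyIntegrand_truncPow (α := 2 * a) (a := a)
    ⟨by linarith [ha.1], by linarith [ha.2]⟩ ha.1 hx
  have hcov : AECover volume (𝓝[>] (0 : ℝ))
      (fun ε => Iic (-moebiusShift (-x) ε) ∪ Ioi (moebiusShift x ε)) := by
    refine ⟨?_, fun ε => measurableSet_Iic.union measurableSet_Ioi⟩
    filter_upwards [Measure.ae_ne volume (0 : ℝ)] with z hz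
    rcases lt_or_gt_of_ne hz with h | h
    · filter_upwards [(tendsto_moebiusShift hx').eventually_lt_const (neg_pos.2 h)] with ε hε
      exact Or.inl (by rw [mem_Iic]; linarith)
    · filter_upwards [(tendsto_moebiusShift hx).eventually_lt_const h] with ε hε
      exact Or.inr hε
  have hlim1 := hcov.integral_tendsto_of_countably_generated hint
  obtain ⟨hI, hV⟩ := integral_rpow_neg_div_one_add_mul ha hb
  have hlim2 := ((((tendsto_setIntegral_Ioi_nhdsGT hI).const_mul (1 - x ^ 2)).neg.add
    (tendsto_rpow_neg_mul_second_diff ha hx)).const_mul ((1 - x ^ 2) ^ (-a))).sub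
    ((tendsto_integral_moebiusShift ha hx).const_mul (deriv (truncPow a) x))
  have heq := tendsto_nhds_unique_of_eventuallyEq hlim1 hlim2 (by
    filter_upwards [Ioc_mem_nhdsGT (by norm_num : (0 : ℝ) < 1 / 2)] with ε hε
    exact setIntegral_levyIntegrand_truncPow_union ha hx hε)
  rw [heq, hV, Real.rpow_sub hb, Real.rpow_one, Real.rpow_neg hb.le]
  have : (1 - x ^ 2) ^ a ≠ 0 := by positivity
  field_simp
  ring

theorem getoorFun_eq_truncPow {α : ℝ} (hα : 0 < α) (x : ℝ) :
    getoorFun α x = getoorConst α * truncPow (α / 2) x := by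
  rw [getoorFun]
  split_ifs with h
  · rw [truncPow_of_abs_le h.le, sq_abs]
  · rw [truncPow_of_one_le_abs (by positivity) (not_lt.1 h), mul_zero]

theorem getoorConst_pos {α : ℝ} (hα : 0 < α) : 0 < getoorConst α := by
  have h1 := Real.Gamma_pos_of_pos (by norm_num : (0 : ℝ) < 1 / 2)
  have h2 := Real.Gamma_pos_of_pos (by positivity : 0 < 1 + α / 2)
  have h3 := Real.Gamma_pos_of_pos (by positivity : 0 < (1 + α) / 2)
  unfold getoorConst
  positivity

theorem levyConst_mul_getoorConst {α : ℝ} (hα : α ∈ Ioo (0 : ℝ) 2) :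
    getoorConst α * (levyConst α * (Real.Gamma (1 - α / 2) * Real.Gamma (α / 2))) = 1 := by
  have ha : 0 < α := hα.1
  have h2 := (Real.Gamma_pos_of_pos (by positivity : 0 < α / 2)).ne'
  have h3 := (Real.Gamma_pos_of_pos (by positivity : 0 < (1 + α) / 2)).ne'
  have h4 := (Real.Gamma_pos_of_pos (by linarith [hα.2] : 0 < 1 - α / 2)).ne'
  have h5 : √Real.pi ≠ 0 := (Real.sqrt_pos.2 Real.pi_pos).ne'
  have h6 : (2 : ℝ) ^ α ≠ 0 := by positivity
  rw [getoorConst, levyConst, Real.Gamma_one_half_eq, add_comm 1 (α / 2),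
    Real.Gamma_add_one (by positivity), Real.rpow_sub two_pos, Real.rpow_one]
  generalize Real.Gamma (1 - α / 2) = G at h4 ⊢
  field_simp

theorem hasFracLapAt_getoorFun {α x : ℝ} (hα : α ∈ Ioo (0 : ℝ) 2) (hx : x ∈ Ioo (-1 : ℝ) 1) :
    HasFracLapAt α (getoorFun α) x 1 := by
  have ha : α / 2 ∈ Ioo (0 : ℝ) 1 := ⟨by linarith [hα.1], by linarith [hα.2]⟩
  have h : HasFracLapAt α (truncPow (α / 2)) x
      (levyConst α * (Real.Gamma (1 - α / 2) * Real.Gamma (α / 2))) := by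
    refine ⟨(hasDerivAt_truncPow hx).differentiableAt,
      integrable_levyIntegrand_truncPow hα ha.1 hx, ?_⟩
    have := integral_levyIntegrand_truncPow ha hx
    rw [mul_div_cancel₀ _ two_ne_zero] at this
    rw [this]
    ring
  have := h.const_mul (getoorConst α)
  rw [levyConst_mul_getoorConst hα] at this
  rwa [funext (getoorFun_eq_truncPow hα.1)]

/-! ### The primitive of Getoor's function -/

theorem continuous_getoorFun {α : ℝ} (hα : 0 < α) : Continuous (getoorFun α) := by
  rw [funext (getoorFun_eq_truncPow hα)]
  exact continuous_const.mul (continuous_truncPow (by positivity))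

theorem getoorFun_nonneg {α : ℝ} (hα : 0 < α) (x : ℝ) : 0 ≤ getoorFun α x := by
  rw [getoorFun_eq_truncPow hα]
  exact mul_nonneg (getoorConst_pos hα).le (truncPow_nonneg _ _)

theorem getoorFun_of_one_le_abs {α x : ℝ} (hx : 1 ≤ |x|) : getoorFun α x = 0 :=
  if_neg (not_lt.2 hx)

theorem getoorFun_neg (α x : ℝ) : getoorFun α (-x) = getoorFun α x := by
  simp [getoorFun]

/-- The primitive of Getoor's function that vanishes to the left of `-1`. -/
noncomputable def getoorPrim (α x : ℝ) : ℝ := ∫ t in (-1 : ℝ)..x, getoorFun α t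

/-- The total integral of Getoor's function. -/
noncomputable def getoorMass (α : ℝ) : ℝ := getoorPrim α 1

theorem hasDerivAt_getoorPrim {α : ℝ} (hα : 0 < α) (x : ℝ) :
    HasDerivAt (getoorPrim α) (getoorFun α x) x :=
  intervalIntegral.integral_hasDerivAt_right ((continuous_getoorFun hα).intervalIntegrable _ _)
    (continuous_getoorFun hα).stronglyMeasurable.stronglyMeasurableAtFilter
    (continuous_getoorFun hα).continuousAt

theorem deriv_getoorPrim {α : ℝ} (hα : 0 < α) : deriv (getoorPrim α) = getoorFun α :=
  funext fun x => (hasDerivAt_getoorPrim hα x).deriv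

theorem continuous_getoorPrim {α : ℝ} (hα : 0 < α) : Continuous (getoorPrim α) :=
  continuous_iff_continuousAt.2 fun x => (hasDerivAt_getoorPrim hα x).continuousAt

theorem monotone_getoorPrim {α : ℝ} (hα : 0 < α) : Monotone (getoorPrim α) :=
  monotone_of_hasDerivAt_nonneg (hasDerivAt_getoorPrim hα) fun x => getoorFun_nonneg hα x

theorem getoorPrim_of_le {α x : ℝ} (hx : x ≤ -1) : getoorPrim α x = 0 := by
  rw [getoorPrim, intervalIntegral.integral_symm, intervalIntegral.integral_of_le hx,
    setIntegral_eq_zero_of_forall_eq_zero, neg_zero]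
  intro t ht
  exact getoorFun_of_one_le_abs (le_abs.2 (Or.inr (by linarith [ht.2])))

theorem getoorPrim_of_ge {α x : ℝ} (hα : 0 < α) (hx : 1 ≤ x) :
    getoorPrim α x = getoorMass α := by
  have hi := fun a b => (continuous_getoorFun hα).intervalIntegrable (μ := volume) a b
  rw [getoorMass, getoorPrim, getoorPrim,
    ← intervalIntegral.integral_add_adjacent_intervals (hi (-1) 1) (hi 1 x), add_eq_left,
    intervalIntegral.integral_of_le hx, setIntegral_eq_zero_of_forall_eq_zero]
  intro t ht
  exact getoorFun_of_one_le_abs (le_abs.2 (Or.inl ht.1.le))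

theorem getoorMass_pos {α : ℝ} (hα : 0 < α) : 0 < getoorMass α := by
  refine intervalIntegral.intervalIntegral_pos_of_pos_on
    ((continuous_getoorFun hα).intervalIntegrable _ _) (fun x hx => ?_) (by norm_num)
  rw [getoorFun_eq_truncPow hα, truncPow_of_abs_le (abs_le.2 ⟨hx.1.le, hx.2.le⟩)]
  exact mul_pos (getoorConst_pos hα) (Real.rpow_pos_of_pos (one_sub_sq_pos hx) _)

theorem getoorPrim_sub_zero_odd {α : ℝ} (x : ℝ) (hα : 0 < α) :
    getoorPrim α (-x) - getoorPrim α 0 = -(getoorPrim α x - getoorPrim α 0) := by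
  have hi := fun a b => (continuous_getoorFun hα).intervalIntegrable (μ := volume) a b
  have h : ∀ y, getoorPrim α y - getoorPrim α 0 = ∫ t in (0 : ℝ)..y, getoorFun α t := fun y => by
    rw [sub_eq_iff_eq_add']
    exact (intervalIntegral.integral_add_adjacent_intervals (hi _ _) (hi _ _)).symm
  rw [h, h, ← intervalIntegral.integral_symm]
  have := intervalIntegral.integral_comp_neg (a := 0) (b := -x) (getoorFun α)
  simpa only [getoorFun_neg, neg_neg, neg_zero] using this

theorem abs_getoorPrim_le {α : ℝ} (hα : 0 < α) (x : ℝ) : |getoorPrim α x| ≤ getoorMass α := by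
  have h0 : 0 ≤ getoorPrim α x := by
    rw [← getoorPrim_of_le (α := α) (min_le_right x (-1))]
    exact monotone_getoorPrim hα (min_le_left _ _)
  rw [abs_of_nonneg h0, ← getoorPrim_of_ge hα (le_max_right x 1)]
  exact monotone_getoorPrim hα (le_max_left _ _)

theorem exists_abs_levyIntegrand_getoorPrim_le (α : ℝ) (hα : 0 < α) {x₀ : ℝ}
    (hx : x₀ ∈ Ioo (-1 : ℝ) 1) :
    ∃ C, ∀ z, |levyIntegrand α (getoorPrim α) x₀ z| ≤ C * (min (z ^ 2) 1 / |z| ^ (1 + α)) := by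
  obtain ⟨r, hr, hsub⟩ := exists_closedBall_subset_Ioo hx
  have hc : ContDiffOn ℝ 1 (getoorFun α) (Metric.closedBall x₀ (2 * r)) := by
    have h1 : ContDiffOn ℝ 1 (fun x : ℝ => getoorConst α * (1 - x ^ 2) ^ (α / 2))
        (Metric.closedBall x₀ (2 * r)) := fun x hx =>
      (contDiffAt_const.mul ((contDiffAt_const.sub (contDiffAt_id.pow 2)).rpow_const_of_ne
        (one_sub_sq_pos (hsub hx)).ne')).contDiffWithinAt
    refine h1.congr fun x hx => ?_
    rw [getoorFun_eq_truncPow hα, truncPow_of_abs_le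
      (abs_le.2 ⟨(hsub hx).1.le, (hsub hx).2.le⟩)]
  obtain ⟨K, hK⟩ := hc.exists_lipschitzOnWith one_ne_zero (convex_closedBall _ _)
    (isCompact_closedBall _ _)
  obtain ⟨C, hC⟩ := exists_abs_levyIntegrand_le α hr (abs_getoorPrim_le hα)
    (fun x _ => hasDerivAt_getoorPrim hα x) (L := K) (fun x hx y hy => by
      simpa only [Real.dist_eq] using hK.dist_le_mul x (Metric.ball_subset_closedBall hx) y
        (Metric.ball_subset_closedBall hy))
  exact ⟨C, hC x₀ (Metric.mem_ball_self hr)⟩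

/-- Differentiation of the Lévy–Khintchine integral under the integral sign: `Λ` commutes with
the derivative. -/
theorem hasDerivAt_integral_levyIntegrand_getoorPrim {α x₀ : ℝ} (hα : α ∈ Ioo (0 : ℝ) 2)
    (hx : x₀ ∈ Ioo (-1 : ℝ) 1) :
    HasDerivAt (fun x => ∫ z, levyIntegrand α (getoorPrim α) x z)
      (∫ z, levyIntegrand α (getoorFun α) x₀ z) x₀ := by
  have hcont := continuous_getoorPrim hα.1
  obtain ⟨C₀, hC₀⟩ := exists_abs_levyIntegrand_getoorPrim_le α hα.1 hx
  obtain ⟨r, hr, C, hC⟩ := exists_abs_levyIntegrand_truncPow_le α (half_pos hα.1) hx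
  have hfun : levyIntegrand α (getoorFun α) =
      fun x z => getoorConst α * levyIntegrand α (truncPow (α / 2)) x z := by
    funext x
    rw [funext (getoorFun_eq_truncPow hα.1), levyIntegrand_const_mul]
  have hmeas : ∀ x, AEStronglyMeasurable (levyIntegrand α (getoorPrim α) x) volume := fun x =>
    (Measurable.div (Measurable.sub
      ((hcont.comp (continuous_const.add continuous_id)).sub continuous_const).measurable
      (Measurable.ite (measurableSet_le (by fun_prop) (by fun_prop)) (by fun_prop)
        measurable_const)) (by fun_prop)).aestronglyMeasurable
  refine (hasDerivAt_integral_of_dominated_loc_of_deriv_le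
    (s := Metric.ball x₀ r ∩ Ioo (-1) 1) (F' := levyIntegrand α (getoorFun α))
    (bound := fun z => getoorConst α * (C * (min (z ^ 2) 1 / |z| ^ (1 + α))))
    (inter_mem (Metric.ball_mem_nhds x₀ hr) (isOpen_Ioo.mem_nhds hx))
    (Eventually.of_forall hmeas) (integrable_levyIntegrand hα hcont hC₀)
    (hasFracLapAt_getoorFun hα hx).2.1.aestronglyMeasurable
    (Eventually.of_forall fun z x hx => ?_)
    (((integrable_min_sq_one_div hα).const_mul C).const_mul _)
    (Eventually.of_forall fun z x hx => ?_)).2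
  · rw [hfun, Real.norm_eq_abs, abs_mul, abs_of_pos (getoorConst_pos hα.1)]
    exact mul_le_mul_of_nonneg_left (hC x hx.1 z) (getoorConst_pos hα.1).le
  · simp only [levyIntegrand, deriv_getoorPrim hα.1]
    refine HasDerivAt.div_const ?_ _
    refine (((hasDerivAt_getoorPrim hα.1 (x + z)).comp_add_const x z).sub
      (hasDerivAt_getoorPrim hα.1 x)).sub ?_
    split_ifs
    · exact (hasFracLapAt_getoorFun hα hx.2).1.hasDerivAt.const_mul z
    · exact hasDerivAt_const _ _

/-- `Λ V x - x` has zero derivative on `(-1, 1)` and vanishes at `0`. -/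
theorem hasFracLapAt_getoorPrim {α x : ℝ} (hα : α ∈ Ioo (0 : ℝ) 2) (hx : x ∈ Ioo (-1 : ℝ) 1) :
    HasFracLapAt α (getoorPrim α) x x := by
  obtain ⟨C, hC⟩ := exists_abs_levyIntegrand_getoorPrim_le α hα.1 hx
  refine ⟨(hasDerivAt_getoorPrim hα.1 x).differentiableAt,
    integrable_levyIntegrand hα (continuous_getoorPrim hα.1) hC, ?_⟩
  have hder : ∀ y ∈ Ioo (-1 : ℝ) 1, HasDerivAt
      (fun x => -(levyConst α * ∫ z, levyIntegrand α (getoorPrim α) x z) - x) 0 y := by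
    intro y hy
    have h1 := (((hasDerivAt_integral_levyIntegrand_getoorPrim hα hy).const_mul
      (levyConst α)).neg).sub (hasDerivAt_id y)
    rwa [(hasFracLapAt_getoorFun hα hy).2.2, sub_self] at h1
  have h0 : (0 : ℝ) ∈ Ioo (-1 : ℝ) 1 := by norm_num
  have hconst := isOpen_Ioo.is_const_of_deriv_eq_zero isPreconnected_Ioo
    (fun y hy => (hder y hy).differentiableAt.differentiableWithinAt)
    (fun y hy => (hder y hy).deriv) hx h0
  have hzero : ∫ z, levyIntegrand α (getoorPrim α) 0 z = 0 := by
    refine integral_eq_zero_of_odd fun z => ?_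
    simp only [levyIntegrand, zero_add, abs_neg]
    rw [getoorPrim_sub_zero_odd z hα.1]
    split_ifs <;> ring
  simp only [hzero, mul_zero, neg_zero, sub_zero] at hconst
  linarith

/-! ### Hölder continuity and analyticity -/

/-- `x ↦ (1 - x²)₊` is Lipschitz with constant `2`, in one-sided form. -/
theorem max_one_sub_sq_le (x y : ℝ) :
    max (1 - x ^ 2) 0 ≤ max (1 - y ^ 2) 0 + 2 * |x - y| := by
  have h2 := abs_sub_abs_le_abs_sub y x
  rw [abs_sub_comm] at h2
  refine max_le ?_ (by positivity)
  rw [← sq_abs x, ← sq_abs y]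
  rcases le_total 1 |x| with hx | hx
  · have := le_max_right (1 - |y| ^ 2) 0
    nlinarith [abs_nonneg (x - y)]
  · rcases le_total 1 |y| with hy | hy
    · have := le_max_right (1 - |y| ^ 2) 0
      nlinarith [abs_nonneg x]
    · have := le_max_left (1 - |y| ^ 2) 0
      rcases le_total |x| |y| with h | h
      · nlinarith [abs_nonneg x, abs_nonneg y]
      · nlinarith [abs_nonneg x, abs_nonneg y, abs_nonneg (x - y)]

theorem truncPow_le_add {a : ℝ} (ha : a ∈ Ioo (0 : ℝ) 1) (x y : ℝ) :
    truncPow a x ≤ truncPow a y + 2 ^ a * |x - y| ^ a := by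
  rw [← Real.mul_rpow two_pos.le (abs_nonneg _)]
  exact (Real.rpow_le_rpow (le_max_right _ _) (max_one_sub_sq_le x y) ha.1.le).trans
    (Real.rpow_add_le_add_rpow (le_max_right _ _) (by positivity) ha.1.le ha.2.le)

theorem abs_truncPow_sub_le {a : ℝ} (ha : a ∈ Ioo (0 : ℝ) 1) (x y : ℝ) :
    |truncPow a x - truncPow a y| ≤ 2 ^ a * |x - y| ^ a := by
  have h1 := truncPow_le_add ha x y
  have h2 := truncPow_le_add ha y x
  rw [abs_sub_comm y x] at h2
  exact abs_le.2 ⟨by linarith, by linarith⟩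

/-- Analyticity of the primitive inside `(-1, 1)`: there it is, up to a constant, the real part of
a holomorphic primitive of `z ↦ (1 - z²) ^ (α / 2)` on the unit disc. -/
theorem analyticAt_getoorPrim {α x : ℝ} (hα : 0 < α) (hx : x ∈ Ioo (-1 : ℝ) 1) :
    AnalyticAt ℝ (getoorPrim α) x := by
  have hslit : ∀ z ∈ Metric.ball (0 : ℂ) 1, 1 - z ^ 2 ∈ Complex.slitPlane := by
    intro z hz
    left
    have h1 : ‖z‖ < 1 := by simpa using hz
    have h2 := Complex.re_le_norm (z ^ 2)
    rw [norm_pow] at h2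
    have h3 : ‖z‖ ^ 2 < 1 := by nlinarith [norm_nonneg z]
    rw [Complex.sub_re, Complex.one_re]
    linarith
  have hdiff : DifferentiableOn ℂ (fun z : ℂ => (1 - z ^ 2) ^ ((α / 2 : ℝ) : ℂ))
      (Metric.ball 0 1) := by
    intro z hz
    have h1 : DifferentiableAt ℂ (fun z : ℂ => 1 - z ^ 2) z := by fun_prop
    exact (h1.cpow (differentiableAt_const _) (hslit z hz)).differentiableWithinAt
  obtain ⟨F, hF⟩ := hdiff.isExactOn_ball
  have hball : ∀ y ∈ Ioo (-1 : ℝ) 1, (y : ℂ) ∈ Metric.ball (0 : ℂ) 1 := by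
    intro y hy
    rw [mem_ball_zero_iff, Complex.norm_real, Real.norm_eq_abs]
    exact abs_lt.2 hy
  have hFan : AnalyticAt ℝ (fun y : ℝ => (F y).re) x := by
    have h1 : AnalyticAt ℂ F (x : ℂ) :=
      (show DifferentiableOn ℂ F (Metric.ball 0 1) from fun z hz =>
        (hF z hz).differentiableAt.differentiableWithinAt).analyticAt
        (Metric.isOpen_ball.mem_nhds (hball x hx))
    exact h1.re_ofReal
  have hder : ∀ y ∈ Ioo (-1 : ℝ) 1,
      HasDerivAt (fun y : ℝ => getoorPrim α y - getoorConst α * (F y).re) 0 y := by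
    intro y hy
    have h1 := (hF y (hball y hy)).real_of_complex
    have h2 := (hasDerivAt_getoorPrim hα y).sub (h1.const_mul (getoorConst α))
    refine h2.congr_deriv ?_
    have h3 : (1 - (y : ℂ) ^ 2) ^ ((α / 2 : ℝ) : ℂ) = (((1 - y ^ 2) ^ (α / 2) : ℝ) : ℂ) := by
      rw [Complex.ofReal_cpow (one_sub_sq_pos hy).le]
      push_cast
      rfl
    simp only [h3]
    rw [Complex.ofReal_re, getoorFun_eq_truncPow hα,
      truncPow_of_abs_le (abs_le.2 ⟨hy.1.le, hy.2.le⟩), sub_self]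
  have hconst : ∀ y ∈ Ioo (-1 : ℝ) 1, getoorPrim α y - getoorConst α * (F y).re =
      getoorPrim α x - getoorConst α * (F x).re := fun y hy =>
    isOpen_Ioo.is_const_of_deriv_eq_zero isPreconnected_Ioo
      (fun y hy => (hder y hy).differentiableAt.differentiableWithinAt)
      (fun y hy => (hder y hy).deriv) hy hx
  refine ((analyticAt_const (v := getoorPrim α x - getoorConst α * (F x).re)).add
    ((analyticAt_const (v := getoorConst α)).mul hFan)).congr ?_
  filter_upwards [isOpen_Ioo.mem_nhds hx] with y hy
  have := hconst y hy
  simp only [Pi.add_apply, Pi.mul_apply]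
  linarith

/-! ### The self-similar profile -/

theorem theorem1 (α : ℝ) (hα : α ∈ Set.Ioo (0 : ℝ) 2) :
    (∀ x ∈ Set.Ioo (-1 : ℝ) 1, HasFracLapAt α (getoorFun α) x 1) ∧
    ∃ (Φ : ℝ → ℝ) (yα : ℝ), 0 < yα ∧
      Monotone Φ ∧
      IsC1Holder (α / 2) Φ ∧
      AnalyticOnNhd ℝ Φ (Set.Ioo (-yα) yα) ∧
      (∀ y ∈ Set.Iio (-yα), Φ y = 0) ∧
      (∀ y ∈ Set.Ioi yα, Φ y = 1) ∧
      (∀ y ∈ Set.Ioo (-yα) yα, HasFracLapAt α Φ y (y / (α + 1))) ∧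
      ∃ c : ℝ, 0 < c ∧ ∀ y : ℝ, Φ y = c * ∫ t in (-yα)..y, getoorFun α (t / yα) := by
  refine ⟨fun x hx => hasFracLapAt_getoorFun hα hx, ?_⟩
  have hα0 : 0 < α := hα.1
  have ha : α / 2 ∈ Ioo (0 : ℝ) 1 := ⟨by linarith [hα.1], by linarith [hα.2]⟩
  set M := getoorMass α
  have hM : 0 < M := getoorMass_pos hα0
  -- The two scaling constraints are `k * M = 1` (jump of size one) and
  -- `k * r⁻¹ ^ α * r⁻¹ = 1 / (α + 1)` (slope of `Λ Φ`), for `Φ y = k * getoorPrim α (y / r)`.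
  set r := ((α + 1) / M) ^ (1 / (1 + α)) with hrdef
  have hr : 0 < r := by positivity
  have hrM : r ^ α * r = (α + 1) / M := by
    nth_rewrite 2 [← Real.rpow_one r]
    rw [← Real.rpow_add hr, hrdef, ← Real.rpow_mul (by positivity), add_comm α 1,
      one_div_mul_cancel (by positivity), Real.rpow_one]
  have hmem : ∀ y ∈ Ioo (-r) r, y / r ∈ Ioo (-1 : ℝ) 1 := fun y hy =>
    ⟨by rw [lt_div_iff₀ hr]; linarith [hy.1], by rw [div_lt_one hr]; exact hy.2⟩
  have hder : ∀ y, HasDerivAt (fun y => M⁻¹ * getoorPrim α (y / r))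
      (M⁻¹ / r * getoorFun α (y / r)) y := by
    intro y
    have := ((hasDerivAt_getoorPrim hα0 (y / r)).comp y
      ((hasDerivAt_id y).div_const r)).const_mul M⁻¹
    refine this.congr_deriv ?_
    ring
  have hderiv : deriv (fun y => M⁻¹ * getoorPrim α (y / r)) =
      fun y => M⁻¹ / r * getoorFun α (y / r) := funext fun y => (hder y).deriv
  refine ⟨fun y => M⁻¹ * getoorPrim α (y / r), r, hr, ?_, ⟨?_, ?_⟩, ?_, ?_, ?_, ?_, ?_⟩
  · intro x y hxy
    have := monotone_getoorPrim hα0 ((div_le_div_iff_of_pos_right hr).2 hxy)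
    exact mul_le_mul_of_nonneg_left this (by positivity)
  · rw [contDiff_one_iff_deriv, hderiv]
    exact ⟨fun y => (hder y).differentiableAt, continuous_const.mul
      ((continuous_getoorFun hα0).comp (continuous_id.div_const r))⟩
  · have hK := getoorConst_pos hα0
    set C := M⁻¹ / r * (getoorConst α * (2 ^ (α / 2) * r⁻¹ ^ (α / 2))) with hC
    have hC0 : 0 ≤ C := by positivity
    refine ⟨C.toNNReal, fun x y => ?_⟩
    rw [hderiv, Real.coe_toNNReal _ ha.1.le, edist_dist, edist_dist,
      ENNReal.ofReal_rpow_of_nonneg dist_nonneg ha.1.le,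
      ← ENNReal.ofReal_coe_nnreal, Real.coe_toNNReal _ hC0, ← ENNReal.ofReal_mul hC0]
    refine ENNReal.ofReal_le_ofReal ?_
    have h := abs_truncPow_sub_le ha (x / r) (y / r)
    rw [← sub_div, abs_div, abs_of_pos hr, div_eq_mul_inv |x - y| r,
      Real.mul_rpow (abs_nonneg _) (by positivity)] at h
    simp only [Real.dist_eq]
    rw [getoorFun_eq_truncPow hα0, getoorFun_eq_truncPow hα0,
      ← mul_sub, ← mul_sub, abs_mul, abs_mul, abs_of_pos hK,
      abs_of_pos (by positivity : 0 < M⁻¹ / r)]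
    calc _ ≤ M⁻¹ / r * (getoorConst α * (2 ^ (α / 2) * (|x - y| ^ (α / 2) * r⁻¹ ^ (α / 2)))) := by
          gcongr
      _ = _ := by rw [hC]; ring
  · intro y hy
    have h1 : AnalyticAt ℝ (fun y : ℝ => y / r) y := analyticAt_id.div analyticAt_const hr.ne'
    exact analyticAt_const.mul
      (AnalyticAt.comp (f := fun y : ℝ => y / r) (analyticAt_getoorPrim hα0 (hmem y hy)) h1)
  · intro y hy
    have : y / r ≤ -1 := by rw [div_le_iff₀ hr]; linarith [mem_Iio.1 hy]
    simp only [getoorPrim_of_le this, mul_zero]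
  · intro y hy
    have : 1 ≤ y / r := by rw [one_le_div hr]; exact (mem_Ioi.1 hy).le
    simp only [getoorPrim_of_ge hα0 this]
    exact inv_mul_cancel₀ hM.ne'
  · intro y hy
    have h := ((hasFracLapAt_getoorPrim hα (hmem y hy)).comp_div hr).const_mul M⁻¹
    rw [mul_div_cancel₀ y hr.ne'] at h
    have e : M⁻¹ * (r⁻¹ ^ α * (y / r)) = y / (α + 1) := by
      rw [Real.inv_rpow hr.le]
      have h1 : M⁻¹ * ((r ^ α)⁻¹ * (y / r)) = y / (M * (r ^ α * r)) := by field_simp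
      rw [h1, hrM, mul_div_cancel₀ _ hM.ne']
    rwa [e] at h
  · refine ⟨M⁻¹ / r, by positivity, fun y => ?_⟩
    rw [intervalIntegral.integral_comp_div _ hr.ne', neg_div, div_self hr.ne', smul_eq_mul,
      ← getoorPrim]
    field_simp
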